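/- Let $\Bbbk$ be a field of characteristic zero, $t\in\Bbbk$, and $T=e^{ht}\in\Bbbk[[h]]$. Let $A_1$ be the Weyl–Heisenberg algebra over $\Bbbk$ with generators $\mathbf x,\mathbf p$ and relation $\mathbf p\mathbf x-\mathbf x\mathbf p=1$, let $A_n=A_1^{\otimes n}$ with generators $\mathbf x_i,\mathbf p_i$, and consider their $h$-adic deformations $A_n[[h]]$. Let $\mathcal N$ be the normal ordering map, i.e. the $\Bbbk$-linear map, extended coefficientwise in $h$, with $\mathcal N(\prod_i x_i^{\alpha_i}p_i^{\beta_i})=\prod_i\mathbf x_i^{\alpha_i}\prod_i\mathbf p_i^{\beta_i}$. Put $\mathcal A_n=\exp(h\,\mathrm{Mat}_n(\Bbbk[[h]]))$ and, for $Q\in\mathcal A_n$, $\varphi(Q)=\mathcal N(\exp(x^{\top}(Q-\mathbf 1)p))\in A_n[[h]]$. Set $$R=\varphi\begin{pmatrix}T&0\\1-T^2&T\end{pmatrix}\in (A_1\otimes A_1)[[h]],\qquad \kappa=1 .$$ Let $\mathcal K$ be a long knot, and let $D$ be an upward diagram of $\mathcal K$: it begins and ends with an upward strand and both strands are oriented upward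 at every crossing. Number the edges of $D$ (the arcs between consecutive passages through crossings) consecutively along the orientation, and let $i^+=i+1$. For a crossing $c$ let $s=\pm1$ be its sign, and let $i$ and $j$ be the incoming edges of its over- and under-strand. *Universal invariant.* Put $R^{s}$ at every crossing, with the first tensor factor on the edge $i$ and the second one on the edge $j$, and $\kappa^{\pm1}$ for each full counterclockwise (resp. clockwise) turn of an edge. Multiplying these labels from right to left along the knot gives $Z\in A_1[[h]]$. Let $\widetilde{\mathcal K}$ be the closed knot obtained from $\mathcal K$ by trivially closing its open component; the element $Z$ is taken as the universal invariant $Z_{\mathscr A}(\widetilde{\mathcal K})$, where $\mathscr A=(A_1,R,\kappa)$. A scalar part of $Z$ is an $\omega\in\Bbbk[[h]]$ with $Z=\omega\cdot\varphi(Q)$ for some $Q\in\mathcal A_1$. *Alexander polynomial.* Let $A=I+\sum_c A_c$, where the rows and columns are indexed by the edges of $D$ and the only nonzero contributions of $A_c$ are $-T^s$ at $(i,i^+)$, $T^s-1$ at $(i,j^+)$ and $-1$ at $(j,j^+)$. Let $\Delta_{\widetilde{\mathcal K}}(T)=\det A\in\mathbb Z[T^{\pm1}]$; as an invariant of $\widetilde{\mathcal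 K}$ it is defined up to units $\pm T^m$. **Theorem.** For every long knot $\mathcal K$ and every upward diagram $D$ of $\mathcal K$, the element $Z$ has exactly one scalar part $\omega$, and $$\omega\cdot\Delta_{\widetilde{\mathcal K}}(T^2)=\pm T^{n}\quad\text{for some } n\in\mathbb Z \text{ and some sign},$$ that is, $\omega$ is the inverse $\Delta_{\widetilde{\mathcal K}}(T^2)^{-1}$ of the Alexander polynomial evaluated at $T^2$, up to a unit $\pm T^n$. -/

import Mathlib

open scoped TensorProduct Nat
open PowerSeries (X)

noncomputable section

/-! ### Upward diagrams of long knots -/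

/-- A point in which a generic horizontal line meets a partially drawn diagram.
`edge` is the running index of the edge that passes through it (edges are the arcs between
consecutive passages through crossings, numbered `0, 1, 2, …` along the orientation), `turn` is
the number of local maxima and minima that the strand has met since it entered this edge, and `up`
tells whether the strand is oriented upward there. -/
structure Strand where
  edge : ℕ
  turn : ℕ
  up : Bool

/-- `UpwardTangle w` is the type of (Morse presentations of) the parts of an upward long knot
diagram that lie below a horizontal line, where `w` lists, from left to right, the points in which
the diagram meets the line.  A diagram starts with a single upward strand and is drawn from bottom
to top, one crossing, maximum or minimum at a time.  Both strands are oriented upward at each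
crossing.  The pair `(edge, turn)` increases lexicographically along the orientation at each
crossing, maximum and minimum, so no closed component can occur. -/
inductive UpwardTangle : List Strand → Type
  /-- The initial upward strand. -/
  | start : UpwardTangle [⟨0, 0, true⟩]
  /-- A crossing of two upward strands.  The incoming edges are `a` (lower left) and `b` (lower
  right), the outgoing ones are `b + 1` (upper left) and `a + 1` (upper right).  The crossing is
  positive, that is, the strand from the lower left to the upper right is the over-strand, if
  `pos` is `true`; otherwise it is negative and that strand is the under-strand. -/
  | crossing (pos : Bool) {l r : List Strand} {a b u v : ℕ}
      (d : UpwardTangle (l ++ ⟨a, u, true⟩ :: ⟨b, v, true⟩ :: r)) :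
      UpwardTangle (l ++ ⟨b + 1, 0, true⟩ :: ⟨a + 1, 0, true⟩ :: r)
  /-- A maximum run through from right to left: a counterclockwise half turn. -/
  | maxLeft {l r : List Strand} {a u : ℕ}
      (d : UpwardTangle (l ++ ⟨a, u + 1, false⟩ :: ⟨a, u, true⟩ :: r)) :
      UpwardTangle (l ++ r)
  /-- A maximum run through from left to right: a clockwise half turn. -/
  | maxRight {l r : List Strand} {a u : ℕ}
      (d : UpwardTangle (l ++ ⟨a, u, true⟩ :: ⟨a, u + 1, false⟩ :: r)) :
      UpwardTangle (l ++ r)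
  /-- A minimum run through from left to right: a counterclockwise half turn. -/
  | minRight {l r : List Strand} (a u : ℕ) (d : UpwardTangle (l ++ r)) :
      UpwardTangle (l ++ ⟨a, u, false⟩ :: ⟨a, u + 1, true⟩ :: r)
  /-- A minimum run through from right to left: a clockwise half turn. -/
  | minLeft {l r : List Strand} (a u : ℕ) (d : UpwardTangle (l ++ r)) :
      UpwardTangle (l ++ ⟨a, u + 1, true⟩ :: ⟨a, u, false⟩ :: r)

/-- A crossing: its sign, and the incoming edges of its over-strand and of its under-strand. -/
structure Crossing where
  pos : Bool
  overEdge : ℕ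
  underEdge : ℕ

/-- The sign `s = ±1` of a crossing. -/
def Crossing.sign (c : Crossing) : ℤ := if c.pos then 1 else -1

namespace UpwardTangle

/-- The list of crossings of a diagram. -/
def crossings : {w : List Strand} → UpwardTangle w → List Crossing
  | _, start => []
  | _, @crossing pos _ _ a b _ _ d =>
      (if pos then ⟨pos, a, b⟩ else ⟨pos, b, a⟩) :: crossings d
  | _, maxLeft d => crossings d
  | _, maxRight d => crossings d
  | _, minRight _ _ d => crossings d
  | _, minLeft _ _ d => crossings d

/-- The number of counterclockwise half turns minus the number of clockwise half turns of the
edge `e`. -/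
def halfTurns (e : ℕ) : {w : List Strand} → UpwardTangle w → ℤ
  | _, start => 0
  | _, crossing _ d => halfTurns e d
  | _, @maxLeft _ _ a _ d => halfTurns e d + if a = e then 1 else 0
  | _, @maxRight _ _ a _ d => halfTurns e d - if a = e then 1 else 0
  | _, minRight a _ d => halfTurns e d + if a = e then 1 else 0
  | _, minLeft a _ d => halfTurns e d - if a = e then 1 else 0

end UpwardTangle

/-- An upward diagram of a long knot: an upward tangle diagram that starts and ends with a single
upward strand.  Its edges are `0, 1, …, lastEdge`; if it has `n` crossings, then
`lastEdge = 2 * n`. -/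
structure UpwardKnotDiagram where
  lastEdge : ℕ
  lastTurn : ℕ
  tangle : UpwardTangle [⟨lastEdge, lastTurn, true⟩]

/-! ### The Alexander polynomial -/

namespace UpwardKnotDiagram

variable (D : UpwardKnotDiagram)

/-- The set of edges of `D`. -/
abbrev Edge : Type := Fin (D.lastEdge + 1)

/-- The edge with running index `e`, for `e ≤ D.lastEdge`. -/
def edge (e : ℕ) : D.Edge := Fin.ofNat (D.lastEdge + 1) e

open LaurentPolynomial in
/-- The contribution `A_c` of a crossing `c` with over-strand `i → i⁺ = i + 1` and under-strand
`j → j⁺ = j + 1`: the entries are `-T ^ s` at `(i, i⁺)`, `T ^ s - 1` at `(i, j⁺)`, `-1` at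
`(j, j⁺)`, and zero elsewhere. -/
def crossingMatrix (c : Crossing) : Matrix D.Edge D.Edge (LaurentPolynomial ℤ) :=
  Matrix.single (D.edge c.overEdge) (D.edge (c.overEdge + 1)) (-T c.sign) +
  Matrix.single (D.edge c.overEdge) (D.edge (c.underEdge + 1)) (T c.sign - 1) +
  Matrix.single (D.edge c.underEdge) (D.edge (c.underEdge + 1)) (-1)

/-- The Alexander matrix `A = I + ∑ A_c`, the sum being over all crossings. -/
def alexanderMatrix : Matrix D.Edge D.Edge (LaurentPolynomial ℤ) :=
  1 + (D.tangle.crossings.map D.crossingMatrix).sum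

/-- The Alexander polynomial computed from the diagram `D` (as a knot invariant, it is defined up
to units `± T ^ m`). -/
def alexanderPolynomial : LaurentPolynomial ℤ := D.alexanderMatrix.det

end UpwardKnotDiagram

/-! ### Tensor legs, contraction and the universal invariant

For a `k`-algebra `B`, the (topological) trivial deformation of `B` over `k⟦h⟧` is `B⟦X⟧`, where
`X` plays the role of `h`; `k`-linear maps are applied to it coefficientwise. -/

section UniversalInvariant

variable {k : Type*} [Field k]

/-- The `h`-linear extension of a linear map to the trivial deformations. -/
def deform {V W : Type*} [Ring V] [Algebra k V] [Ring W] [Algebra k W]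
    (f : V →ₗ[k] W) (z : PowerSeries V) : PowerSeries W :=
  PowerSeries.mk fun d => f (PowerSeries.coeff d z)

variable {A : Type*} [Ring A] [Algebra k A]

/-- The placement of a two-fold tensor on the legs `i` (first factor) and `j` (second factor) of
`A^{⊗ I}`, with `1` on all other legs, for `i ≠ j`. -/
def placeLegs {I : Type*} [DecidableEq I] (i j : I) :
    (⨂[k] _ : Fin 2, A) →ₗ[k] (⨂[k] _ : I, A) :=
  PiTensorProduct.lift
    ((MultilinearMap.mkPiAlgebraFin k 2 (⨂[k] _ : I, A)).compLinearMap
      ![(PiTensorProduct.singleAlgHom (R := k) (A := fun _ : I => A) i).toLinearMap,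
        (PiTensorProduct.singleAlgHom (R := k) (A := fun _ : I => A) j).toLinearMap])

/-- The contraction `a₀ ⊗ a₁ ⊗ ⋯ ⊗ aₘ ↦ aₘ ⋯ a₁ a₀` of all legs, which multiplies the legs from
right to left. For `n = 1` this is the canonical isomorphism from `A^{⊗ 1}` to `A`. -/
def contractLegs (n : ℕ) : (⨂[k] _ : Fin n, A) →ₗ[k] A :=
  PiTensorProduct.lift
    ((MultilinearMap.mkPiAlgebraFin k n A).domDomCongr (Fin.revPerm : Equiv.Perm (Fin n)))

namespace UpwardKnotDiagram

variable (D : UpwardKnotDiagram)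

/-- The bead of a crossing: `R` for a positive and `R⁻¹` for a negative crossing, with the first
tensor factor on the incoming edge of the over-strand and the second one on the incoming edge of
the under-strand. -/
def crossingBead (R : (PowerSeries (⨂[k] _ : Fin 2, A))ˣ) (c : Crossing) :
    PowerSeries (⨂[k] _ : D.Edge, A) :=
  deform (placeLegs (k := k) (A := A) (D.edge c.overEdge) (D.edge c.underEdge))
    ((R ^ c.sign : (PowerSeries (⨂[k] _ : Fin 2, A))ˣ) : PowerSeries (⨂[k] _ : Fin 2, A))

/-- The bead `κ ^ r` of an edge, where `r` is the number of its full counterclockwise turns. -/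
def turnBead (κ : (PowerSeries A)ˣ) (e : D.Edge) : PowerSeries (⨂[k] _ : D.Edge, A) :=
  deform (PiTensorProduct.singleAlgHom (R := k) (A := fun _ : D.Edge => A) e).toLinearMap
    ((κ ^ (D.tangle.halfTurns e / 2) : (PowerSeries A)ˣ) : PowerSeries A)

/-- The universal invariant of (the diagram `D` of) a long knot with respect to the algebra `A`
(deformed over `k⟦h⟧`) and the elements `R` and `κ`: the labels of the beads that are met when one
traverses the knot, multiplied from right to left.  On each edge, the bead of its turns comes
before the bead of the crossing at which it ends. -/
def universalInvariant (R : (PowerSeries (⨂[k] _ : Fin 2, A))ˣ) (κ : (PowerSeries A)ˣ) :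
    PowerSeries A :=
  deform (contractLegs (k := k) (A := A) (D.lastEdge + 1))
    ((D.tangle.crossings.map (D.crossingBead R)).prod *
      (List.ofFn (D.turnBead (k := k) κ)).prod)

end UpwardKnotDiagram

end UniversalInvariant

/-! ### The Weyl–Heisenberg algebra -/

section Heisenberg

/-- The two generators `x` and `p`. -/
inductive HeisenbergGen : Type
  | x
  | p

/-- The defining relation `p x - x p = 1`. -/
inductive HeisenbergRel (k : Type*) [Field k] :
    FreeAlgebra k HeisenbergGen → FreeAlgebra k HeisenbergGen → Prop
  | comm : HeisenbergRel k
      (FreeAlgebra.ι k HeisenbergGen.p * FreeAlgebra.ι k HeisenbergGen.x -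
        FreeAlgebra.ι k HeisenbergGen.x * FreeAlgebra.ι k HeisenbergGen.p) 1

/-- The Weyl–Heisenberg algebra in one pair of generators. The algebra in `n` pairs of generators
is its `n`-th tensor power. -/
abbrev Heisenberg (k : Type*) [Field k] : Type _ := RingQuot (HeisenbergRel k)

/-- The `n`-th Weyl–Heisenberg algebra `A_n`, as the `n`-th tensor power of `A_1`. -/
abbrev HeisenbergPow (k : Type*) [Field k] (n : ℕ) : Type _ := ⨂[k] _ : Fin n, Heisenberg k

variable {k : Type*} [Field k]

/-- The generators of the Weyl–Heisenberg algebra. -/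
def heisenbergGen (g : HeisenbergGen) : Heisenberg k :=
  RingQuot.mkAlgHom k (HeisenbergRel k) (FreeAlgebra.ι k g)

/-- The normal ordering map, which sends the monomial `∏ x_i ^ α_i p_i ^ β_i` to the tensor product
of the `x ^ α_i p ^ β_i`. The variable `x_i` is `Sum.inl i`, and `p_i` is `Sum.inr i`. -/
def normalOrder (n : ℕ) : MvPolynomial (Fin n ⊕ Fin n) k →ₗ[k] HeisenbergPow k n :=
  (MvPolynomial.basisMonomials (Fin n ⊕ Fin n) k).constr k fun m =>
    PiTensorProduct.tprod k fun i =>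
      heisenbergGen .x ^ m (Sum.inl i) * heisenbergGen .p ^ m (Sum.inr i)

/-- The exponential series `exp f = ∑ f ^ m / m!` of a power series `f` in `h` with constant term
zero; since `f ^ m` is divisible by `h ^ m`, the terms with `m > d` do not contribute to the
coefficient of `h ^ d`. -/
def hexp {B : Type*} [Ring B] [Algebra k B] (f : PowerSeries B) : PowerSeries B :=
  PowerSeries.mk fun d =>
    ∑ m ∈ Finset.range (d + 1), ((m ! : k)⁻¹) • PowerSeries.coeff d (f ^ m)

/-- The exponential of a matrix over `k⟦h⟧` with entries divisible by `h`. -/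
def matrixExp {n : ℕ} (M : Matrix (Fin n) (Fin n) (PowerSeries k)) :
    Matrix (Fin n) (Fin n) (PowerSeries k) :=
  Matrix.of fun i j => PowerSeries.mk fun d =>
    ∑ m ∈ Finset.range (d + 1), ((m ! : k)⁻¹) • PowerSeries.coeff d ((M ^ m) i j)

/-- The set `𝒜_n = exp (h Mat_n (k⟦h⟧))`. -/
def expMatrices (k : Type*) [Field k] (n : ℕ) : Set (Matrix (Fin n) (Fin n) (PowerSeries k)) :=
  {Q | ∃ B : Matrix (Fin n) (Fin n) (PowerSeries k), Q = matrixExp ((X : PowerSeries k) • B)}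

/-- The quadratic form `xᵀ M p`. -/
def quadraticForm {n : ℕ} (M : Matrix (Fin n) (Fin n) (PowerSeries k)) :
    PowerSeries (MvPolynomial (Fin n ⊕ Fin n) k) :=
  ∑ i, ∑ j, PowerSeries.map MvPolynomial.C (M i j) *
    PowerSeries.C (MvPolynomial.X (Sum.inl i) * MvPolynomial.X (Sum.inr j))

/-- The map `φ(Q) = 𝒩 (exp (xᵀ (Q - 1) p))`, for `Q` congruent to `1` modulo `h`. -/
def gaussian {n : ℕ} (Q : Matrix (Fin n) (Fin n) (PowerSeries k)) :
    PowerSeries (HeisenbergPow k n) :=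
  deform (normalOrder n) (hexp (k := k) (quadraticForm (Q - 1)))

/-- `ω` is a scalar part of `Z`: one has `Z = ω · φ(Q)` for some `Q` in `𝒜_1`. -/
def IsScalarPart (Z : PowerSeries (Heisenberg k)) (ω : PowerSeries k) : Prop :=
  ∃ Q ∈ expMatrices k 1,
    Z = PowerSeries.map (algebraMap k (Heisenberg k)) ω * deform (contractLegs 1) (gaussian Q)

theorem constantCoeff_gaussian {n : ℕ} (Q : Matrix (Fin n) (Fin n) (PowerSeries k)) :
    PowerSeries.constantCoeff (gaussian Q) = 1 := by
  have h : PowerSeries.constantCoeff (gaussian Q) =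
      normalOrder n (PowerSeries.coeff 0 (hexp (k := k) (quadraticForm (Q - 1)))) := by
    rw [← PowerSeries.coeff_zero_eq_constantCoeff_apply, gaussian, deform, PowerSeries.coeff_mk]
  have h1 : (1 : MvPolynomial (Fin n ⊕ Fin n) k) =
      MvPolynomial.basisMonomials (Fin n ⊕ Fin n) k 0 := by
    simp
  rw [h]
  simp only [hexp, PowerSeries.coeff_mk, zero_add, Finset.sum_range_one, pow_zero,
    Nat.factorial_zero, Nat.cast_one, inv_one, one_smul, PowerSeries.coeff_zero_one]
  rw [h1, normalOrder, Module.Basis.constr_basis]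
  simp only [Finsupp.coe_zero, Pi.zero_apply, pow_zero, mul_one]
  rfl

/-- `φ(Q)` as an invertible element. -/
def gaussianUnit {n : ℕ} (Q : Matrix (Fin n) (Fin n) (PowerSeries k)) :
    (PowerSeries (HeisenbergPow k n))ˣ where
  val := gaussian Q
  inv := PowerSeries.invOfUnit (gaussian Q) 1
  val_inv := PowerSeries.mul_invOfUnit _ _ (constantCoeff_gaussian Q)
  inv_val := PowerSeries.invOfUnit_mul _ _ (constantCoeff_gaussian Q)

variable [CharZero k]

/-- The invertible power series `T = e ^ (h t)`. -/
def expT (t : k) : (PowerSeries k)ˣ where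
  val := PowerSeries.rescale t (PowerSeries.exp k)
  inv := PowerSeries.rescale (-t) (PowerSeries.exp k)
  val_inv := by
    rw [PowerSeries.exp_mul_exp_eq_exp_add, add_neg_cancel, PowerSeries.rescale_zero_apply]
    simp
  inv_val := by
    rw [PowerSeries.exp_mul_exp_eq_exp_add, neg_add_cancel, PowerSeries.rescale_zero_apply]
    simp

/-- The element `R = φ(M)` with `M = [[T, 0], [1 - T², T]]`. -/
def heisenbergR (t : k) : (PowerSeries (HeisenbergPow k 2))ˣ :=
  gaussianUnit !![(expT t : PowerSeries k), 0; 1 - (expT t : PowerSeries k) ^ 2, expT t]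

end Heisenberg

end

noncomputable section

open Finset.HasAntidiagonal (antidiagonal mem_antidiagonal)
open PowerSeries (C coeff constantCoeff)
open scoped PowerSeries

/-!
The invariant `Z` is the contraction of a product of beads, and this product is a Gaussian
`b = φ(Q)` on the legs `0, …, m`: it satisfies `b xᵢ = ∑ⱼ Qⱼᵢ xⱼ b`, `pᵢ b = ∑ⱼ Qᵢⱼ b pⱼ` and
`∂b/∂h = ∑ᵢⱼ (∂Qᵢⱼ/∂h) xᵢ b pⱼ`. The contraction glues the end of each leg to the beginning of the
next one, which turns these relations into linear systems with the matrix `B = 1 - Qᵀ S`, where `S`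
is the shift matrix.

As `(B⁻¹)₀ₘ = 1`, the systems show that `Z` commutes with `x` and `p`. The centre of the
Weyl–Heisenberg algebra consists of the scalars, so `Z` equals its vacuum expectation `ω`; this is
the only possible scalar part, because the vacuum expectation of every `φ(Q)` is `1`. By Jacobi's
formula, `ω · det B` has derivative zero in `h`, and hence it is equal to `1`. Finally, conjugating
by `diag(T ^ μ)`, where `μ` is the Alexander numbering of the edges, turns `B` into the Alexander
matrix evaluated at `T²`.
-/

/-! ### Power series over noncommutative algebras -/

section Deformation

variable {k : Type*} [Field k]

/-- The trivial deformation `B⟦h⟧` of a `k`-algebra `B`, as an algebra over `k⟦h⟧`.  For `B = k`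
its scalar multiplication agrees with the multiplication of `k⟦h⟧`, but not definitionally. -/
instance deformationAlgebra {B : Type*} [Ring B] [Algebra k B] : Algebra k⟦X⟧ B⟦X⟧ :=
  (PowerSeries.map (algebraMap k B)).toAlgebra' fun c z => by
    ext n
    simp only [PowerSeries.coeff_mul, PowerSeries.coeff_map]
    rw [← Finset.Nat.sum_antidiagonal_swap]
    exact Finset.sum_congr rfl fun _ _ => Algebra.commutes _ _

section

variable {B : Type*} [Ring B]

/-- The derivation `d/dh` of `B⟦h⟧`.  Mathlib's `PowerSeries.derivative` is restricted to
commutative `B`. -/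
def hderiv : B⟦X⟧ →+ B⟦X⟧ where
  toFun z := PowerSeries.mk fun n => (n + 1) • coeff (n + 1) z
  map_zero' := by ext; simp
  map_add' y z := by ext; simp

theorem coeff_hderiv (z : B⟦X⟧) (n : ℕ) : coeff n (hderiv z) = (n + 1) • coeff (n + 1) z :=
  PowerSeries.coeff_mk n fun n => (n + 1) • coeff (n + 1) z

@[simp]
theorem hderiv_C (b : B) : hderiv (C b) = 0 := by
  ext n
  simp [coeff_hderiv]

@[simp]
theorem hderiv_one : hderiv (1 : B⟦X⟧) = 0 := by
  simpa using hderiv_C (1 : B)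

theorem hderiv_mul (y z : B⟦X⟧) : hderiv (y * z) = hderiv y * z + y * hderiv z := by
  ext n
  have leibniz : (n + 1) • coeff (n + 1) (y * z) =
      ∑ q ∈ antidiagonal (n + 1),
        (q.1 • coeff q.1 y * coeff q.2 z + coeff q.1 y * q.2 • coeff q.2 z) := by
    rw [PowerSeries.coeff_mul, Finset.smul_sum]
    refine Finset.sum_congr rfl fun q hq => ?_
    rw [← mem_antidiagonal.1 hq, add_smul, smul_mul_assoc, mul_smul_comm]
  rw [coeff_hderiv, leibniz, Finset.sum_add_distrib, Finset.Nat.sum_antidiagonal_succ,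
    Finset.Nat.sum_antidiagonal_succ']
  simp [PowerSeries.coeff_mul, coeff_hderiv]

theorem eq_C_of_hderiv_eq_zero [IsAddTorsionFree B] {z : B⟦X⟧} (h : hderiv z = 0) :
    z = C (constantCoeff z) := by
  ext (_ | n)
  · simp
  · have := congrArg (coeff n) h
    rw [coeff_hderiv, map_zero, smul_eq_zero_iff_right n.succ_ne_zero] at this
    rw [this, PowerSeries.coeff_succ_C]

end

section

variable {B : Type*} [Ring B] [Algebra k B]

theorem smul_eq_map_mul (c : k⟦X⟧) (z : B⟦X⟧) :
    c • z = PowerSeries.map (algebraMap k B) c * z := rfl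

theorem coeff_smul_eq_sum (c : k⟦X⟧) (z : B⟦X⟧) (n : ℕ) :
    coeff n (c • z) = ∑ q ∈ antidiagonal n, coeff q.1 c • coeff q.2 z := by
  rw [smul_eq_map_mul, PowerSeries.coeff_mul]
  simp only [PowerSeries.coeff_map, Algebra.smul_def]

theorem hderiv_smul (c : k⟦X⟧) (z : B⟦X⟧) :
    hderiv (c • z) = d⁄dX k c • z + c • hderiv z := by
  have hderiv_map : hderiv (PowerSeries.map (algebraMap k B) c) =
      PowerSeries.map (algebraMap k B) (d⁄dX k c) := by
    ext n
    simp [coeff_hderiv, PowerSeries.coeff_derivative, mul_comm]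
  simp only [smul_eq_map_mul, hderiv_mul, hderiv_map]

end

section

variable {U V W : Type*} [Ring U] [Algebra k U] [Ring V] [Algebra k V] [Ring W] [Algebra k W]

@[simp]
theorem coeff_deform (f : V →ₗ[k] W) (z : V⟦X⟧) (n : ℕ) :
    coeff n (deform f z) = f (coeff n z) := by
  simp [deform]

theorem deform_add (f : V →ₗ[k] W) (y z : V⟦X⟧) :
    deform f (y + z) = deform f y + deform f z := by
  ext; simp

theorem deform_sum (f : V →ₗ[k] W) {ι : Type*} (s : Finset ι) (z : ι → V⟦X⟧) :
    deform f (∑ i ∈ s, z i) = ∑ i ∈ s, deform f (z i) := by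
  ext; simp

theorem deform_smul (f : V →ₗ[k] W) (c : k⟦X⟧) (z : V⟦X⟧) :
    deform f (c • z) = c • deform f z := by
  ext; simp [coeff_smul_eq_sum]

theorem deform_functional_smul (f : V →ₗ[k] k) (c : k⟦X⟧) (z : V⟦X⟧) :
    deform f (c • z) = c * deform f z := by
  ext; simp [coeff_smul_eq_sum, PowerSeries.coeff_mul]

theorem deform_hderiv (f : V →ₗ[k] W) (z : V⟦X⟧) : deform f (hderiv z) = hderiv (deform f z) := by
  ext; simp only [coeff_deform, coeff_hderiv, map_nsmul]

@[simp]
theorem deform_C (f : V →ₗ[k] W) (a : V) : deform f (C a) = C (f a) := by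
  ext
  simp only [coeff_deform, PowerSeries.coeff_C]
  split_ifs <;> simp

theorem deform_deform (g : V →ₗ[k] W) (f : U →ₗ[k] V) (z : U⟦X⟧) :
    deform g (deform f z) = deform (g ∘ₗ f) z := by
  ext; simp

theorem deform_algHom (f : V →ₐ[k] W) (z : V⟦X⟧) :
    deform f.toLinearMap z = PowerSeries.map (f : V →+* W) z := by
  ext; simp

end

end Deformation

/-! ### Gaussian elements -/

section GaussianElements

variable {k : Type*} [Field k] {B : Type*} [Ring B] [Algebra k B]
  {ι : Type*} [Fintype ι] [DecidableEq ι] {x p : ι → B}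

/-- The relations that characterize `b` as the normally ordered exponential of `xᵀ (Q - 1) p`, for
families `x` and `p` in `B`: commutation with `x` and `p`, and a differential equation in `h`. They
make sense without a normal ordering on `B`, and they are stable under products. -/
structure IsGaussian (x p : ι → B) (b : B⟦X⟧) (Q : Matrix ι ι k⟦X⟧) : Prop where
  constantCoeff_eq : constantCoeff b = 1
  constantCoeff_matrix : Q.map constantCoeff = 1
  mul_x : ∀ i, b * C (x i) = ∑ j, Q j i • (C (x j) * b)
  p_mul : ∀ i, C (p i) * b = ∑ j, Q i j • (b * C (p j))
  hderiv_eq : hderiv b = ∑ i, ∑ j, d⁄dX k (Q i j) • (C (x i) * b * C (p j))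

namespace IsGaussian

theorem one : IsGaussian (k := k) x p 1 1 where
  constantCoeff_eq := map_one _
  constantCoeff_matrix := Matrix.map_one _ (map_zero _) (map_one _)
  mul_x i := by simp [Matrix.one_apply]
  p_mul i := by simp [Matrix.one_apply]
  hderiv_eq := by simp [Matrix.one_apply, apply_ite (d⁄dX k)]

theorem mul {b₁ b₂ : B⟦X⟧} {Q₁ Q₂ : Matrix ι ι k⟦X⟧}
    (h₁ : IsGaussian x p b₁ Q₁) (h₂ : IsGaussian x p b₂ Q₂) :
    IsGaussian x p (b₁ * b₂) (Q₁ * Q₂) where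
  constantCoeff_eq := by rw [map_mul, h₁.constantCoeff_eq, h₂.constantCoeff_eq, one_mul]
  constantCoeff_matrix := by
    rw [Matrix.map_mul, h₁.constantCoeff_matrix, h₂.constantCoeff_matrix, one_mul]
  mul_x i := by
    rw [mul_assoc, h₂.mul_x, Finset.mul_sum]
    simp only [mul_smul_comm, ← mul_assoc, h₁.mul_x, Finset.sum_mul, smul_mul_assoc,
      Finset.smul_sum, smul_smul, Matrix.mul_apply, Finset.sum_smul]
    rw [Finset.sum_comm]
    simp only [mul_comm]
  p_mul i := by
    rw [← mul_assoc, h₁.p_mul, Finset.sum_mul]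
    simp only [smul_mul_assoc, mul_assoc, h₂.p_mul, Finset.mul_sum, mul_smul_comm,
      Finset.smul_sum, smul_smul, Matrix.mul_apply, Finset.sum_smul]
    rw [Finset.sum_comm]
  hderiv_eq := by
    have left : hderiv b₁ * b₂ = ∑ i, ∑ j, ∑ l,
        (d⁄dX k (Q₁ i l) * Q₂ l j) • (C (x i) * (b₁ * b₂) * C (p j)) := by
      rw [h₁.hderiv_eq]
      simp only [Finset.sum_mul, smul_mul_assoc, mul_assoc, h₂.p_mul, Finset.mul_sum,
        mul_smul_comm, Finset.smul_sum, smul_smul]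
      exact Finset.sum_congr rfl fun i _ => Finset.sum_comm
    have right : b₁ * hderiv b₂ = ∑ i, ∑ j, ∑ l,
        (Q₁ i l * d⁄dX k (Q₂ l j)) • (C (x i) * (b₁ * b₂) * C (p j)) := by
      rw [h₂.hderiv_eq]
      simp only [Finset.mul_sum, mul_smul_comm, ← mul_assoc, h₁.mul_x, Finset.sum_mul,
        smul_mul_assoc, Finset.smul_sum, smul_smul]
      simp only [mul_comm (d⁄dX k _)]
      rw [Finset.sum_comm, Finset.sum_congr rfl fun _ _ => Finset.sum_comm, Finset.sum_comm]
    rw [hderiv_mul, left, right]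
    simp only [Matrix.mul_apply, map_sum, Derivation.leibniz, smul_eq_mul, Finset.sum_smul,
      ← Finset.sum_add_distrib, ← add_smul]
    exact Finset.sum_congr rfl fun _ _ => Finset.sum_congr rfl fun _ _ =>
      Finset.sum_congr rfl fun _ _ => by congr 1; ring

theorem list_prod {α : Type*} (l : List α) (b : α → B⟦X⟧) (Q : α → Matrix ι ι k⟦X⟧)
    (h : ∀ a ∈ l, IsGaussian x p (b a) (Q a)) :
    IsGaussian x p (l.map b).prod (l.map Q).prod := by
  induction l with
  | nil => exact one
  | cons a l ih =>
    simp only [List.map_cons, List.prod_cons]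
    exact (h a List.mem_cons_self).mul (ih fun c hc => h c (List.mem_cons_of_mem a hc))

theorem eq_one [CharZero k] {b : B⟦X⟧} (h : IsGaussian (k := k) x p b 1) : b = 1 := by
  have : IsAddTorsionFree B := .of_isTorsionFree k B
  have hderiv_b : hderiv b = 0 := by
    rw [h.hderiv_eq]
    simp [Matrix.one_apply, apply_ite (d⁄dX k)]
  rw [eq_C_of_hderiv_eq_zero hderiv_b, h.constantCoeff_eq, map_one]

end IsGaussian

end GaussianElements

/-! ### The exponential series -/

section HExp

variable {k : Type*} [Field k] {B : Type*} [CommRing B] [Algebra k B]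

/-- The coefficientwise extension of a derivation of `B` to `B⟦h⟧`. -/
def deformDerivation (δ : Derivation k B B) : Derivation k B⟦X⟧ B⟦X⟧ :=
  Derivation.mk'
    { toFun := deform δ.toLinearMap
      map_add' := deform_add _
      map_smul' := fun c z => by ext; simp }
    fun y z => by
      ext n
      simp only [LinearMap.coe_mk, AddHom.coe_mk, coeff_deform, PowerSeries.coeff_mul, map_add,
        map_sum, Derivation.coeFn_coe, Derivation.leibniz, smul_eq_mul, Finset.sum_add_distrib]
      rw [← Finset.Nat.sum_antidiagonal_swap (f := fun q => coeff q.1 z * _)]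
      rfl

theorem deformDerivation_apply (δ : Derivation k B B) (z : B⟦X⟧) :
    deformDerivation δ z = deform δ.toLinearMap z := rfl

theorem hderiv_eq_derivative (z : B⟦X⟧) :
    hderiv z = (d⁄dX B).restrictScalars k z := by
  ext n
  simp [coeff_hderiv, PowerSeries.coeff_derivative, mul_comm]

theorem X_pow_dvd_derivation (δ : Derivation k B⟦X⟧ B⟦X⟧) {M : ℕ} {z : B⟦X⟧}
    (h : X ^ (M + 1) ∣ z) : X ^ M ∣ δ z := by
  obtain ⟨y, rfl⟩ := h
  rw [Derivation.leibniz, Derivation.leibniz_pow]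
  exact dvd_add (dvd_mul_of_dvd_left (pow_dvd_pow X M.le_succ) _)
    (dvd_mul_of_dvd_right (dvd_smul_of_dvd _ (dvd_mul_right _ (δ X))) y)

theorem X_pow_dvd_hexp_sub_sum {f : B⟦X⟧} (hf : constantCoeff f = 0) (M : ℕ) :
    X ^ M ∣ hexp (k := k) f - ∑ m ∈ Finset.range M, ((m ! : k)⁻¹) • f ^ m := by
  refine PowerSeries.X_pow_dvd_iff.2 fun d hd => ?_
  simp only [hexp, map_sub, PowerSeries.coeff_mk, map_sum, PowerSeries.coeff_smul, sub_eq_zero]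
  refine Finset.sum_subset (Finset.range_mono hd) fun m _ hm => ?_
  have hfm : X ^ m ∣ f ^ m := pow_dvd_pow_of_dvd (PowerSeries.X_dvd_iff.2 hf) m
  rw [PowerSeries.X_pow_dvd_iff.1 hfm d (by simpa using hm), smul_zero]

theorem derivation_sum_inv_factorial_smul_pow [CharZero k] (δ : Derivation k B B) (f : B)
    (M : ℕ) :
    δ (∑ m ∈ Finset.range (M + 1), ((m ! : k)⁻¹) • f ^ m) =
      (∑ m ∈ Finset.range M, ((m ! : k)⁻¹) • f ^ m) * δ f := by
  rw [Finset.sum_range_succ', map_add, map_sum, Finset.sum_mul]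
  simp only [Derivation.map_smul, Derivation.leibniz_pow, pow_zero, Derivation.map_one_eq_zero,
    smul_zero, add_zero, add_tsub_cancel_right, smul_eq_mul, smul_mul_assoc]
  refine Finset.sum_congr rfl fun m _ => ?_
  rw [← Nat.cast_smul_eq_nsmul k, smul_smul, Nat.factorial_succ, Nat.cast_mul, mul_inv,
    mul_right_comm, inv_mul_cancel₀ (Nat.cast_ne_zero.2 m.succ_ne_zero), one_mul]

theorem derivation_hexp [CharZero k] (δ : Derivation k B⟦X⟧ B⟦X⟧) {f : B⟦X⟧}
    (hf : constantCoeff f = 0) : δ (hexp (k := k) f) = hexp (k := k) f * δ f := by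
  have dvd (M : ℕ) : X ^ M ∣ δ (hexp (k := k) f) - hexp (k := k) f * δ f := by
    have := dvd_sub (X_pow_dvd_derivation δ (X_pow_dvd_hexp_sub_sum (k := k) hf (M + 1)))
      ((X_pow_dvd_hexp_sub_sum (k := k) hf M).mul_right (δ f))
    rwa [map_sub, derivation_sum_inv_factorial_smul_pow, sub_mul, sub_sub_sub_cancel_right] at this
  refine sub_eq_zero.1 (PowerSeries.ext fun d => ?_)
  rw [PowerSeries.X_pow_dvd_iff.1 (dvd (d + 1)) d d.lt_succ_self, map_zero]

end HExp

section

variable {k : Type*} [Field k] {B B' : Type*} [Ring B] [Algebra k B] [Ring B'] [Algebra k B']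

@[simp]
theorem hexp_zero : hexp (k := k) (0 : B⟦X⟧) = 1 := by
  ext d
  simp [hexp, Finset.sum_range_succ']

@[simp]
theorem constantCoeff_hexp (f : B⟦X⟧) : constantCoeff (hexp (k := k) f) = 1 := by
  rw [← PowerSeries.coeff_zero_eq_constantCoeff_apply]
  simp [hexp]

theorem map_hexp (g : B →ₐ[k] B') (f : B⟦X⟧) :
    PowerSeries.map (g : B →+* B') (hexp (k := k) f) =
      hexp (k := k) (PowerSeries.map (g : B →+* B') f) := by
  ext d
  simp [hexp, ← map_pow]

end

/-! ### Normal orderings -/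

section NormalOrdering

variable {k : Type*} [Field k] {B : Type*} [Ring B] [Algebra k B]

/-- `N` writes the commutative polynomials in the variables `x_i` (`Sum.inl i`) and `p_i`
(`Sum.inr i`) in terms of elements `x i` and `p i` of `B` that satisfy the canonical commutation
relations, with the `x i` to the left of the `p i`. -/
structure IsNormalOrdering {σ : Type*} [DecidableEq σ] (N : MvPolynomial (σ ⊕ σ) k →ₗ[k] B)
    (x p : σ → B) : Prop where
  map_one : N 1 = 1
  map_x_mul : ∀ i f, N (.X (Sum.inl i) * f) = x i * N f
  map_p_mul : ∀ i f, N (.X (Sum.inr i) * f) = N f * p i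
  p_mul_x : ∀ i j, p i * x j = x j * p i + if i = j then 1 else 0

/-- A functional with the properties of the vacuum expectation value `b ↦ ⟨0| b |0⟩`, where
`⟨0| x i = 0` and `p i |0⟩ = 0`. -/
structure IsVacuumExpectation {σ : Type*} (v : B →ₗ[k] k) (x p : σ → B) : Prop where
  map_one : v 1 = 1
  map_x_mul : ∀ i b, v (x i * b) = 0
  map_mul_p : ∀ i b, v (b * p i) = 0

namespace IsNormalOrdering

variable {σ : Type*} [DecidableEq σ] {N : MvPolynomial (σ ⊕ σ) k →ₗ[k] B} {x p : σ → B}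

theorem map_C (hN : IsNormalOrdering N x p) (a : k) : N (.C a) = algebraMap k B a := by
  rw [← mul_one (MvPolynomial.C a), ← MvPolynomial.smul_eq_C_mul, map_smul, hN.map_one,
    Algebra.algebraMap_eq_smul_one]

theorem commute_x (hN : IsNormalOrdering N x p) (i j : σ) : Commute (x i) (x j) := by
  have h := congrArg N (mul_left_comm (.X (Sum.inl i)) (.X (Sum.inl j)) 1)
  rwa [hN.map_x_mul, hN.map_x_mul, hN.map_x_mul, hN.map_x_mul, hN.map_one, mul_one, mul_one] at h

theorem commute_p (hN : IsNormalOrdering N x p) (i j : σ) : Commute (p i) (p j) := by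
  have h := congrArg N (mul_left_comm (.X (Sum.inr j)) (.X (Sum.inr i)) 1)
  rwa [hN.map_p_mul, hN.map_p_mul, hN.map_p_mul, hN.map_p_mul, hN.map_one, one_mul, one_mul] at h

theorem map_mul_x (hN : IsNormalOrdering N x p) (i : σ) (f : MvPolynomial (σ ⊕ σ) k) :
    N f * x i = x i * N f + N (MvPolynomial.pderiv (Sum.inr i) f) := by
  induction f using MvPolynomial.induction_on with
  | C a => simp [hN.map_C, Algebra.commutes]
  | add f g hf hg => simp only [map_add, add_mul, mul_add, hf, hg]; abel
  | mul_X f s hf =>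
    rw [mul_comm f, MvPolynomial.pderiv_mul, map_add]
    cases s with
    | inl j =>
      rw [MvPolynomial.pderiv_X_of_ne Sum.inl_ne_inr]
      simp only [hN.map_x_mul, mul_assoc, hf, mul_add, zero_mul, _root_.map_zero, zero_add]
      rw [← mul_assoc, (hN.commute_x j i).eq, mul_assoc]
    | inr j =>
      rw [hN.map_p_mul, mul_assoc, hN.p_mul_x, mul_add, ← mul_assoc, hf, hN.map_p_mul,
        MvPolynomial.pderiv_X, Pi.single_apply]
      simp only [Sum.inr.injEq]
      split_ifs <;>
        simp only [mul_zero, mul_one, zero_mul, one_mul, _root_.map_zero, add_mul, mul_assoc,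
          add_zero, zero_add]
      abel

theorem p_mul_map (hN : IsNormalOrdering N x p) (i : σ) (f : MvPolynomial (σ ⊕ σ) k) :
    p i * N f = N f * p i + N (MvPolynomial.pderiv (Sum.inl i) f) := by
  induction f using MvPolynomial.induction_on with
  | C a => simp [hN.map_C, Algebra.commutes]
  | add f g hf hg => simp only [map_add, add_mul, mul_add, hf, hg]; abel
  | mul_X f s hf =>
    rw [mul_comm f, MvPolynomial.pderiv_mul, map_add]
    cases s with
    | inl j =>
      rw [hN.map_x_mul, ← mul_assoc, hN.p_mul_x]
      simp only [hN.map_x_mul, add_mul, mul_assoc, hf, mul_add,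
        MvPolynomial.pderiv_X, Pi.single_apply, Sum.inl.injEq, eq_comm (a := i)]
      split_ifs <;> simp only [zero_mul, one_mul, _root_.map_zero, add_zero, zero_add]
      abel
    | inr j =>
      rw [MvPolynomial.pderiv_X_of_ne Sum.inr_ne_inl]
      simp only [hN.map_p_mul, ← mul_assoc, hf, add_mul, zero_mul, _root_.map_zero, zero_add]
      rw [mul_assoc, (hN.commute_p i j).eq, mul_assoc]

theorem map {B' : Type*} [Ring B'] [Algebra k B'] (hN : IsNormalOrdering N x p)
    (g : B →ₐ[k] B') : IsNormalOrdering (g.toLinearMap ∘ₗ N) (g ∘ x) (g ∘ p) where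
  map_one := by simp [hN.map_one]
  map_x_mul i f := by simp [hN.map_x_mul]
  map_p_mul i f := by simp [hN.map_p_mul]
  p_mul_x i j := by simp [← map_mul, hN.p_mul_x, apply_ite g]

theorem vacuum_map (hN : IsNormalOrdering N x p) {v : B →ₗ[k] k}
    (hv : IsVacuumExpectation v x p) (f : MvPolynomial (σ ⊕ σ) k) :
    v (N f) = MvPolynomial.constantCoeff f := by
  induction f using MvPolynomial.induction_on with
  | C a => simp [hN.map_C, Algebra.algebraMap_eq_smul_one, hv.map_one]
  | add f g hf hg => simp only [map_add, hf, hg]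
  | mul_X f s _ =>
    rw [mul_comm]
    cases s with
    | inl i => simp [hN.map_x_mul, hv.map_x_mul]
    | inr i => simp [hN.map_p_mul, hv.map_mul_p]

theorem map_pderiv_eq_zero (hN : IsNormalOrdering N x p) {f : MvPolynomial (σ ⊕ σ) k}
    (hx : ∀ i, Commute (x i) (N f)) (hp : ∀ i, Commute (p i) (N f)) (s : σ ⊕ σ) :
    N (MvPolynomial.pderiv s f) = 0 := by
  cases s with
  | inl i => exact left_eq_add.1 ((hp i).symm.eq.trans (hN.p_mul_map i f))
  | inr i => exact left_eq_add.1 ((hx i).eq.trans (hN.map_mul_x i f))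

theorem surjective (hN : IsNormalOrdering N x p)
    (hB : Algebra.adjoin k (Set.range x ∪ Set.range p) = ⊤) : Function.Surjective N := by
  intro b
  suffices h : ∀ f, ∃ g, N g = b * N f by simpa [hN.map_one] using h 1
  induction (hB ▸ Algebra.mem_top : b ∈ Algebra.adjoin k _) using Algebra.adjoin_induction with
  | mem b hb =>
    rcases hb with ⟨i, rfl⟩ | ⟨i, rfl⟩ <;> intro f
    · exact ⟨_, hN.map_x_mul i f⟩
    · exact ⟨_, (map_add N _ _).trans (hN.map_p_mul i f ▸ hN.p_mul_map i f).symm⟩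
  | algebraMap r => exact fun f => ⟨r • f, by rw [map_smul, Algebra.smul_def]⟩
  | add b c _ _ hb hc =>
    intro f
    obtain ⟨⟨g, hg⟩, g', hg'⟩ := hb f, hc f
    exact ⟨g + g', by rw [map_add, hg, hg', add_mul]⟩
  | mul b c _ _ hb hc =>
    intro f
    obtain ⟨g, hg⟩ := hc f
    obtain ⟨g', hg'⟩ := hb g
    exact ⟨g', by rw [hg', hg, mul_assoc]⟩

end IsNormalOrdering

theorem eq_C_of_pderiv_eq_zero [CharZero k] {τ : Type*} {f : MvPolynomial τ k}
    (h : ∀ i, MvPolynomial.pderiv i f = 0) : f = .C (MvPolynomial.constantCoeff f) := by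
  refine MvPolynomial.coe_injective _ _ (MvPowerSeries.pderiv.ext (fun i => ?_) ?_)
  · rw [MvPowerSeries.pderiv_coe, MvPowerSeries.pderiv_coe, h, MvPolynomial.pderiv_C]
  · rw [← MvPowerSeries.coeff_zero_eq_constantCoeff_apply,
      ← MvPowerSeries.coeff_zero_eq_constantCoeff_apply, MvPolynomial.coeff_coe,
      MvPolynomial.coeff_coe, MvPolynomial.coeff_zero_C, MvPolynomial.constantCoeff_eq]

theorem eq_bot_of_pderiv_mem_of_constantCoeff_eq_zero [CharZero k] {τ : Type*}
    {K : Submodule k (MvPolynomial τ k)} (hK : ∀ f ∈ K, ∀ i, MvPolynomial.pderiv i f ∈ K)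
    (hK₀ : ∀ f ∈ K, MvPolynomial.constantCoeff f = 0) : K = ⊥ := by
  have coeff_eq_zero (n : ℕ) : ∀ f ∈ K, ∀ m : τ →₀ ℕ, m.degree = n → f.coeff m = 0 := by
    induction n with
    | zero =>
      intro f hf m hm
      rw [(Finsupp.degree_eq_zero_iff m).1 hm]
      exact hK₀ f hf
    | succ n ih =>
      intro f hf m hm
      obtain ⟨i, hi⟩ : ∃ i, m i ≠ 0 := Finsupp.ne_iff.1 fun (h : m = 0) => by simp [h] at hm
      obtain ⟨m, rfl⟩ := exists_add_of_le (Finsupp.single_le_iff.2 (Nat.one_le_iff_ne_zero.2 hi))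
      have := ih _ (hK f hf i) m (by simpa [add_comm 1] using hm)
      rw [MvPolynomial.coeff_pderiv] at this
      rw [add_comm]
      exact (mul_eq_zero.1 this).resolve_right (by exact_mod_cast (m i).succ_ne_zero)
  exact (Submodule.eq_bot_iff K).2 fun f hf =>
    MvPolynomial.ext _ _ fun m => coeff_eq_zero m.degree f hf m rfl

namespace IsNormalOrdering

variable {σ : Type*} [DecidableEq σ] {N : MvPolynomial (σ ⊕ σ) k →ₗ[k] B} {x p : σ → B}
  {v : B →ₗ[k] k} [CharZero k]

theorem injective (hN : IsNormalOrdering N x p) (hv : IsVacuumExpectation v x p) :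
    Function.Injective N := by
  refine LinearMap.ker_eq_bot.1 (eq_bot_of_pderiv_mem_of_constantCoeff_eq_zero ?_ ?_)
  · intro f (hf : N f = 0)
    exact hN.map_pderiv_eq_zero (fun _ => hf ▸ Commute.zero_right _)
      fun _ => hf ▸ Commute.zero_right _
  · intro f (hf : N f = 0)
    rw [← hN.vacuum_map hv, hf, map_zero]

theorem eq_algebraMap_of_commute (hN : IsNormalOrdering N x p) (hv : IsVacuumExpectation v x p)
    (hB : Algebra.adjoin k (Set.range x ∪ Set.range p) = ⊤) {z : B}
    (hx : ∀ i, Commute (x i) z) (hp : ∀ i, Commute (p i) z) : z = algebraMap k B (v z) := by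
  obtain ⟨f, rfl⟩ := hN.surjective hB z
  have pderiv_eq_zero (s) : MvPolynomial.pderiv s f = 0 :=
    (map_eq_zero_iff N (hN.injective hv)).1 (hN.map_pderiv_eq_zero hx hp s)
  conv_lhs => rw [eq_C_of_pderiv_eq_zero pderiv_eq_zero, hN.map_C]
  rw [hN.vacuum_map hv]

end IsNormalOrdering

end NormalOrdering

/-! ### Normally ordered exponentials of quadratic forms -/

section QuadraticForm

variable {k : Type*} [Field k] {n : ℕ} {B : Type*} [Ring B] [Algebra k B]

theorem quadraticForm_eq_sum_smul (M : Matrix (Fin n) (Fin n) k⟦X⟧) :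
    quadraticForm M = ∑ i, ∑ j, M i j • C (.X (Sum.inl i) * .X (Sum.inr j)) := rfl

theorem deform_quadraticForm (f : MvPolynomial (Fin n ⊕ Fin n) k →ₗ[k] B)
    (M : Matrix (Fin n) (Fin n) k⟦X⟧) :
    deform f (quadraticForm M) =
      ∑ i, ∑ j, M i j • C (f (.X (Sum.inl i) * .X (Sum.inr j))) := by
  simp only [quadraticForm_eq_sum_smul, deform_sum, deform_smul, deform_C]

theorem deform_pderiv_inl_quadraticForm (M : Matrix (Fin n) (Fin n) k⟦X⟧) (i : Fin n) :
    deform (MvPolynomial.pderiv (R := k) (Sum.inl i)).toLinearMap (quadraticForm M) =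
      ∑ j, M i j • C (.X (Sum.inr j)) := by
  rw [deform_quadraticForm, Finset.sum_eq_single i]
  · simp
  · intro l _ hl
    simp [MvPolynomial.pderiv_X, hl]
  · simp

theorem deform_pderiv_inr_quadraticForm (M : Matrix (Fin n) (Fin n) k⟦X⟧) (i : Fin n) :
    deform (MvPolynomial.pderiv (R := k) (Sum.inr i)).toLinearMap (quadraticForm M) =
      ∑ j, M j i • C (.X (Sum.inl j)) := by
  rw [deform_quadraticForm]
  refine Finset.sum_congr rfl fun j _ => ?_
  rw [Finset.sum_eq_single i]
  · simp
  · intro l _ hl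
    simp [MvPolynomial.pderiv_X, hl]
  · simp

theorem hderiv_quadraticForm (M : Matrix (Fin n) (Fin n) k⟦X⟧) :
    hderiv (quadraticForm M) = ∑ i, ∑ j, d⁄dX k (M i j) • C (.X (Sum.inl i) * .X (Sum.inr j)) := by
  simp only [quadraticForm_eq_sum_smul, map_sum, hderiv_smul, hderiv_C, smul_zero, add_zero]

theorem constantCoeff_quadraticForm {M : Matrix (Fin n) (Fin n) k⟦X⟧}
    (hM : M.map constantCoeff = 0) : constantCoeff (quadraticForm M) = 0 := by
  have coeff_entry (i j) : coeff 0 (M i j) = 0 := by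
    simpa using congrFun₂ hM i j
  rw [← PowerSeries.coeff_zero_eq_constantCoeff_apply]
  simp [quadraticForm_eq_sum_smul, coeff_smul_eq_sum, coeff_entry]

namespace IsNormalOrdering

variable {N : MvPolynomial (Fin n ⊕ Fin n) k →ₗ[k] B} {x p : Fin n → B}

theorem deform_mul_x (hN : IsNormalOrdering N x p) (i : Fin n)
    (z : (MvPolynomial (Fin n ⊕ Fin n) k)⟦X⟧) :
    deform N z * C (x i) = C (x i) * deform N z +
      deform N (deformDerivation (MvPolynomial.pderiv (Sum.inr i)) z) := by
  ext
  simp [deformDerivation_apply, hN.map_mul_x]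

theorem p_mul_deform (hN : IsNormalOrdering N x p) (i : Fin n)
    (z : (MvPolynomial (Fin n ⊕ Fin n) k)⟦X⟧) :
    C (p i) * deform N z = deform N z * C (p i) +
      deform N (deformDerivation (MvPolynomial.pderiv (Sum.inl i)) z) := by
  ext
  simp [deformDerivation_apply, hN.p_mul_map]

theorem deform_mul_X_inl (hN : IsNormalOrdering N x p) (i : Fin n)
    (z : (MvPolynomial (Fin n ⊕ Fin n) k)⟦X⟧) :
    deform N (z * C (.X (Sum.inl i))) = C (x i) * deform N z := by
  ext
  simp [mul_comm _ (MvPolynomial.X _), hN.map_x_mul]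

theorem deform_mul_X_inr (hN : IsNormalOrdering N x p) (i : Fin n)
    (z : (MvPolynomial (Fin n ⊕ Fin n) k)⟦X⟧) :
    deform N (z * C (.X (Sum.inr i))) = deform N z * C (p i) := by
  ext
  simp [mul_comm _ (MvPolynomial.X _), hN.map_p_mul]

variable [CharZero k] {M : Matrix (Fin n) (Fin n) k⟦X⟧}

theorem deform_hexp_mul_x (hN : IsNormalOrdering N x p) (hM : M.map constantCoeff = 0)
    (i : Fin n) :
    deform N (hexp (k := k) (quadraticForm M)) * C (x i) =
      C (x i) * deform N (hexp (k := k) (quadraticForm M)) +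
        ∑ j, M j i • (C (x j) * deform N (hexp (k := k) (quadraticForm M))) := by
  rw [hN.deform_mul_x, derivation_hexp _ (constantCoeff_quadraticForm hM), deformDerivation_apply,
    deform_pderiv_inr_quadraticForm, Finset.mul_sum, deform_sum]
  simp only [mul_smul_comm, deform_smul, hN.deform_mul_X_inl]

theorem p_mul_deform_hexp (hN : IsNormalOrdering N x p) (hM : M.map constantCoeff = 0)
    (i : Fin n) :
    C (p i) * deform N (hexp (k := k) (quadraticForm M)) =
      deform N (hexp (k := k) (quadraticForm M)) * C (p i) +
        ∑ j, M i j • (deform N (hexp (k := k) (quadraticForm M)) * C (p j)) := by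
  rw [hN.p_mul_deform, derivation_hexp _ (constantCoeff_quadraticForm hM), deformDerivation_apply,
    deform_pderiv_inl_quadraticForm, Finset.mul_sum, deform_sum]
  simp only [mul_smul_comm, deform_smul, hN.deform_mul_X_inr]

theorem hderiv_deform_hexp (hN : IsNormalOrdering N x p) (hM : M.map constantCoeff = 0) :
    hderiv (deform N (hexp (k := k) (quadraticForm M))) = ∑ i, ∑ j, d⁄dX k (M i j) •
      (C (x i) * deform N (hexp (k := k) (quadraticForm M)) * C (p j)) := by
  rw [← deform_hderiv, hderiv_eq_derivative (k := k),
    derivation_hexp _ (constantCoeff_quadraticForm hM), ← hderiv_eq_derivative,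
    hderiv_quadraticForm]
  simp only [Finset.mul_sum, mul_smul_comm, deform_sum, deform_smul, map_mul, ← mul_assoc,
    hN.deform_mul_X_inl, hN.deform_mul_X_inr]

theorem isGaussian (hN : IsNormalOrdering N x p) {Q : Matrix (Fin n) (Fin n) k⟦X⟧}
    (hQ : Q.map constantCoeff = 1) :
    IsGaussian x p (deform N (hexp (k := k) (quadraticForm (Q - 1)))) Q := by
  have hM : (Q - 1).map constantCoeff = 0 := by
    rw [Matrix.map_sub _ (map_sub _), hQ, Matrix.map_one _ (map_zero _) (_root_.map_one _),
      sub_self]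
  refine ⟨?_, hQ, fun i => ?_, fun i => ?_, ?_⟩
  · rw [← PowerSeries.coeff_zero_eq_constantCoeff_apply, coeff_deform,
      PowerSeries.coeff_zero_eq_constantCoeff_apply, constantCoeff_hexp, hN.map_one]
  · rw [hN.deform_hexp_mul_x hM]
    simp [sub_smul, Matrix.one_apply]
  · rw [hN.p_mul_deform_hexp hM]
    simp [sub_smul, Matrix.one_apply]
  · rw [hN.hderiv_deform_hexp hM]
    simp [Matrix.one_apply, apply_ite (d⁄dX k)]

omit [CharZero k] in
theorem vacuum_deform_hexp (hN : IsNormalOrdering N x p) {v : B →ₗ[k] k}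
    (hv : IsVacuumExpectation v x p) :
    deform v (deform N (hexp (k := k) (quadraticForm M))) = 1 := by
  have comp_eq : v ∘ₗ N = (MvPolynomial.aeval fun _ => (0 : k)).toLinearMap := by
    ext f
    simp [hN.vacuum_map hv, MvPolynomial.constantCoeff_eq]
  rw [deform_deform, comp_eq, deform_algHom, map_hexp]
  convert hexp_zero
  simp [quadraticForm]

end IsNormalOrdering

end QuadraticForm

/-! ### Tensor legs -/

section TensorLegs

variable {k : Type*} [Field k] {A : Type*} [Ring A] [Algebra k A] {I : Type*}

instance tensorPower_smulCommClass : SMulCommClass k (⨂[k] _ : I, A) (⨂[k] _ : I, A) :=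
  Algebra.to_smulCommClass

instance tensorPower_isScalarTower : IsScalarTower k (⨂[k] _ : I, A) (⨂[k] _ : I, A) :=
  IsScalarTower.right

variable [DecidableEq I]

/-- The placement of an element of `A` on the leg `i` of `A^{⊗ I}`, with `1` on all other legs. -/
abbrev tensorLeg (i : I) : A →ₐ[k] ⨂[k] _ : I, A :=
  PiTensorProduct.singleAlgHom (A := fun _ => A) i

theorem tensorLeg_mul_tprod (i : I) (y : A) (a : I → A) :
    tensorLeg i y * PiTensorProduct.tprod k a =
      PiTensorProduct.tprod k (Function.update a i (y * a i)) := by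
  rw [PiTensorProduct.singleAlgHom_apply, PiTensorProduct.tprod_mul_tprod]
  congr 1
  ext j
  rcases eq_or_ne j i with rfl | h <;> simp [*]

theorem tprod_mul_tensorLeg (i : I) (y : A) (a : I → A) :
    PiTensorProduct.tprod k a * tensorLeg i y =
      PiTensorProduct.tprod k (Function.update a i (a i * y)) := by
  rw [PiTensorProduct.singleAlgHom_apply, PiTensorProduct.tprod_mul_tprod]
  congr 1
  ext j
  rcases eq_or_ne j i with rfl | h <;> simp [*]

theorem commute_tensorLeg {i j : I} (h : i ≠ j) (y z : A) :
    Commute (tensorLeg (k := k) i y) (tensorLeg j z) := by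
  rw [PiTensorProduct.singleAlgHom_apply, PiTensorProduct.singleAlgHom_apply]
  exact (Pi.mulSingle_commute (f := fun _ : I => A) h y z).tprod

theorem contractLegs_tprod (n : ℕ) (a : Fin n → A) :
    contractLegs (k := k) n (PiTensorProduct.tprod k a) =
      (List.ofFn fun i => a (Fin.rev i)).prod := by
  simp [contractLegs, MultilinearMap.mkPiAlgebraFin_apply]

theorem contractLegs_tprod_cons {n : ℕ} (y : A) (a : Fin n → A) :
    contractLegs (k := k) (n + 1) (PiTensorProduct.tprod k (Fin.cons y a : Fin (n + 1) → A)) =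
      contractLegs (k := k) n (PiTensorProduct.tprod k a) * y := by
  rw [contractLegs_tprod, contractLegs_tprod, List.ofFn_succ']
  simp [Fin.rev_castSucc]

theorem contractLegs_tprod_snoc {n : ℕ} (a : Fin n → A) (y : A) :
    contractLegs (k := k) (n + 1) (PiTensorProduct.tprod k (Fin.snoc a y : Fin (n + 1) → A)) =
      y * contractLegs (k := k) n (PiTensorProduct.tprod k a) := by
  rw [contractLegs_tprod, contractLegs_tprod, List.ofFn_succ]
  simp [Fin.rev_succ]

theorem contractLegs_map_one (n : ℕ) : contractLegs (k := k) n (1 : ⨂[k] _ : Fin n, A) = 1 := by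
  rw [PiTensorProduct.one_def, contractLegs_tprod]
  simp

theorem contractLegs_tprod_update {n : ℕ} (i : Fin n) (y : A) (a : Fin (n + 1) → A) :
    contractLegs (k := k) (n + 1)
        (PiTensorProduct.tprod k (Function.update a i.castSucc (y * a i.castSucc))) =
      contractLegs (k := k) (n + 1)
        (PiTensorProduct.tprod k (Function.update a i.succ (a i.succ * y))) := by
  induction n with
  | zero => exact i.elim0
  | succ n ih =>
    cases a using Fin.consCases with | _ y₀ a
    cases i using Fin.cases with
    | zero =>
      cases a using Fin.consCases with | _ y₁ a
      rw [Fin.castSucc_zero, Fin.update_cons_zero, ← Fin.cons_update, Fin.cons_succ,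
        Fin.update_cons_zero]
      simp only [contractLegs_tprod_cons, Fin.cons_zero, mul_assoc]
    | succ i =>
      rw [← Fin.succ_castSucc, ← Fin.cons_update, ← Fin.cons_update, Fin.cons_succ, Fin.cons_succ,
        contractLegs_tprod_cons, contractLegs_tprod_cons, ih]

theorem contractLegs_castSucc_mul {n : ℕ} (i : Fin n) (y : A) (b : ⨂[k] _ : Fin (n + 1), A) :
    contractLegs (n + 1) (tensorLeg i.castSucc y * b) =
      contractLegs (n + 1) (b * tensorLeg i.succ y) := by
  suffices h : contractLegs (n + 1) ∘ₗ LinearMap.mulLeft k (tensorLeg i.castSucc y) =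
      contractLegs (n + 1) ∘ₗ LinearMap.mulRight k (tensorLeg i.succ y) from
    LinearMap.congr_fun h b
  ext a
  simpa [-PiTensorProduct.singleAlgHom_apply, tensorLeg_mul_tprod, tprod_mul_tensorLeg] using
    contractLegs_tprod_update i y a

theorem contractLegs_last_mul {n : ℕ} (y : A) (b : ⨂[k] _ : Fin (n + 1), A) :
    contractLegs (n + 1) (tensorLeg (Fin.last n) y * b) = y * contractLegs (n + 1) b := by
  suffices h : contractLegs (n + 1) ∘ₗ LinearMap.mulLeft k (tensorLeg (Fin.last n) y) =
      LinearMap.mulLeft k y ∘ₗ contractLegs (n + 1) from LinearMap.congr_fun h b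
  ext a
  cases a using Fin.snocCases with | _ a y₀
  simp [-PiTensorProduct.singleAlgHom_apply, tensorLeg_mul_tprod, Fin.update_snoc_last,
    contractLegs_tprod_snoc, mul_assoc]

theorem contractLegs_mul_zero {n : ℕ} (y : A) (b : ⨂[k] _ : Fin (n + 1), A) :
    contractLegs (n + 1) (b * tensorLeg 0 y) = contractLegs (n + 1) b * y := by
  suffices h : contractLegs (n + 1) ∘ₗ LinearMap.mulRight k (tensorLeg 0 y) =
      LinearMap.mulRight k y ∘ₗ contractLegs (n + 1) from LinearMap.congr_fun h b
  ext a
  cases a using Fin.consCases with | _ y₀ a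
  simp [-PiTensorProduct.singleAlgHom_apply, tprod_mul_tensorLeg, Fin.update_cons_zero,
    contractLegs_tprod_cons, mul_assoc]

/-- The canonical isomorphism from `A^{⊗ 1}` to `A`. -/
def contractOneLeg : (⨂[k] _ : Fin 1, A) →ₐ[k] A :=
  AlgHom.ofLinearMap (contractLegs 1) (contractLegs_map_one 1) <|
    (LinearMap.map_mul_iff _).2 <| by
      ext a b
      simp [contractLegs_tprod, PiTensorProduct.tprod_mul_tprod]

theorem contractOneLeg_toLinearMap :
    (contractOneLeg : (⨂[k] _ : Fin 1, A) →ₐ[k] A).toLinearMap = contractLegs 1 := rfl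

theorem contractOneLeg_tensorLeg (i : Fin 1) (y : A) :
    contractOneLeg (tensorLeg (k := k) i y) = y := by
  rw [Subsingleton.elim i 0, ← mul_one (tensorLeg (k := k) 0 y), ← AlgHom.toLinearMap_apply,
    contractOneLeg_toLinearMap, ← Fin.last_zero, contractLegs_last_mul, contractLegs_map_one,
    mul_one]

theorem placeLegs_tprod (i j : I) (a : Fin 2 → A) :
    placeLegs (k := k) i j (PiTensorProduct.tprod k a) = tensorLeg i (a 0) * tensorLeg j (a 1) := by
  simp [-PiTensorProduct.singleAlgHom_apply, placeLegs, MultilinearMap.mkPiAlgebraFin_apply,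
    List.ofFn_succ]

/-- The placement of two-fold tensors on two different legs, as an algebra homomorphism. -/
def placeLegsAlgHom {i j : I} (hij : i ≠ j) : (⨂[k] _ : Fin 2, A) →ₐ[k] ⨂[k] _ : I, A :=
  AlgHom.ofLinearMap (placeLegs i j)
    (by rw [PiTensorProduct.one_def, placeLegs_tprod, Pi.one_apply, Pi.one_apply, map_one, map_one,
      mul_one]) <|
    (LinearMap.map_mul_iff _).2 <| by
      ext a b
      simpa [-PiTensorProduct.singleAlgHom_apply, placeLegs_tprod,
        PiTensorProduct.tprod_mul_tprod] using
        (commute_tensorLeg (k := k) hij (b 0) (a 1)).mul_mul_mul_comm _ _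

theorem placeLegsAlgHom_toLinearMap {i j : I} (hij : i ≠ j) :
    (placeLegsAlgHom (k := k) (A := A) hij).toLinearMap = placeLegs i j := rfl

theorem placeLegsAlgHom_tensorLeg {i j : I} (hij : i ≠ j) (a : Fin 2) (y : A) :
    placeLegsAlgHom hij (tensorLeg (k := k) a y) = tensorLeg (![i, j] a) y := by
  rw [← AlgHom.toLinearMap_apply, placeLegsAlgHom_toLinearMap,
    PiTensorProduct.singleAlgHom_apply (i := a), placeLegs_tprod]
  fin_cases a <;> simp [-PiTensorProduct.singleAlgHom_apply]

theorem commute_tensorLeg_placeLegs {i j l : I} (hi : l ≠ i) (hj : l ≠ j) (y : A)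
    (z : ⨂[k] _ : Fin 2, A) : Commute (tensorLeg (k := k) l y) (placeLegs i j z) := by
  induction z using PiTensorProduct.induction_on with
  | smul_tprod r a =>
    rw [map_smul, placeLegs_tprod]
    exact ((commute_tensorLeg hi _ _).mul_right (commute_tensorLeg hj _ _)).smul_right r
  | add z w hz hw =>
    rw [map_add]
    exact hz.add_right hw

end TensorLegs

/-! ### The Weyl–Heisenberg algebra -/

section WeylHeisenberg

variable {k : Type*} [Field k]

theorem heisenberg_p_mul_x :
    (heisenbergGen .p * heisenbergGen .x : Heisenberg k) =
      heisenbergGen .x * heisenbergGen .p + 1 := by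
  have := RingQuot.mkAlgHom_rel k (HeisenbergRel.comm (k := k))
  rw [map_sub, map_mul, map_mul, map_one] at this
  exact sub_eq_iff_eq_add'.1 this

theorem adjoin_range_heisenbergGen :
    Algebra.adjoin k (Set.range (heisenbergGen (k := k))) = ⊤ := by
  have range_eq : Set.range (heisenbergGen (k := k)) =
      RingQuot.mkAlgHom k (HeisenbergRel k) '' Set.range (FreeAlgebra.ι k) := Set.range_comp _ _
  rw [range_eq, ← AlgHom.map_adjoin, FreeAlgebra.adjoin_range_ι, Algebra.map_top,
    AlgHom.range_eq_top]
  exact RingQuot.mkAlgHom_surjective k _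

/-- The generator `g` of the `i`-th pair of the Weyl–Heisenberg algebra with pairs of generators
indexed by `I`. -/
def legGen {I : Type*} [DecidableEq I] (g : HeisenbergGen) (i : I) : ⨂[k] _ : I, Heisenberg k :=
  tensorLeg i (heisenbergGen g)

theorem legGen_p_mul_legGen_x {I : Type*} [DecidableEq I] (i j : I) :
    (legGen .p i * legGen .x j : ⨂[k] _ : I, Heisenberg k) =
      legGen .x j * legGen .p i + if i = j then 1 else 0 := by
  rcases eq_or_ne i j with rfl | h
  · rw [if_pos rfl, legGen, legGen, ← map_mul, ← map_mul, heisenberg_p_mul_x, map_add, map_one]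
  · rw [if_neg h, add_zero]
    exact commute_tensorLeg h _ _

theorem normalOrder_monomial {n : ℕ} (m : Fin n ⊕ Fin n →₀ ℕ) :
    normalOrder n (MvPolynomial.monomial m (1 : k)) = PiTensorProduct.tprod k fun i =>
      heisenbergGen .x ^ m (Sum.inl i) * heisenbergGen .p ^ m (Sum.inr i) := by
  rw [normalOrder, ← congrFun (MvPolynomial.coe_basisMonomials _ _) m, Module.Basis.constr_basis]

theorem normalOrder_X_inl_mul {n : ℕ} (i : Fin n) (f : MvPolynomial (Fin n ⊕ Fin n) k) :
    normalOrder n (.X (Sum.inl i) * f) = legGen .x i * normalOrder n f := by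
  suffices h : normalOrder n ∘ₗ LinearMap.mulLeft k (.X (Sum.inl i)) =
      LinearMap.mulLeft k (legGen .x i) ∘ₗ normalOrder (k := k) n from LinearMap.congr_fun h f
  refine (MvPolynomial.basisMonomials _ k).ext fun m => ?_
  simp only [LinearMap.comp_apply, LinearMap.mulLeft_apply, MvPolynomial.X,
    MvPolynomial.coe_basisMonomials, MvPolynomial.monomial_mul, one_mul, normalOrder_monomial,
    legGen, tensorLeg_mul_tprod]
  congr 1
  ext j
  rcases eq_or_ne j i with rfl | h
  · simp [pow_add, mul_assoc]
  · simp [h]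

theorem normalOrder_X_inr_mul {n : ℕ} (i : Fin n) (f : MvPolynomial (Fin n ⊕ Fin n) k) :
    normalOrder n (.X (Sum.inr i) * f) = normalOrder n f * legGen .p i := by
  suffices h : normalOrder n ∘ₗ LinearMap.mulLeft k (.X (Sum.inr i)) =
      LinearMap.mulRight k (legGen .p i) ∘ₗ normalOrder (k := k) n from LinearMap.congr_fun h f
  refine (MvPolynomial.basisMonomials _ k).ext fun m => ?_
  simp only [LinearMap.comp_apply, LinearMap.mulLeft_apply, LinearMap.mulRight_apply,
    MvPolynomial.X, MvPolynomial.coe_basisMonomials, MvPolynomial.monomial_mul, one_mul,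
    normalOrder_monomial, legGen, tprod_mul_tensorLeg]
  congr 1
  ext j
  rcases eq_or_ne j i with rfl | h
  · simp [add_comm 1, pow_succ, mul_assoc]
  · simp [h]

theorem isNormalOrdering_normalOrder (n : ℕ) :
    IsNormalOrdering (normalOrder (k := k) n) (legGen .x) (legGen .p) where
  map_one := by
    rw [← MvPolynomial.C_1, MvPolynomial.C_apply, normalOrder_monomial]
    simp [PiTensorProduct.one_def, Pi.one_def]
  map_x_mul := normalOrder_X_inl_mul
  map_p_mul := normalOrder_X_inr_mul
  p_mul_x := legGen_p_mul_legGen_x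

theorem isNormalOrdering_contractLegs_one :
    IsNormalOrdering (contractLegs (k := k) 1 ∘ₗ normalOrder 1) (fun _ => heisenbergGen .x)
      (fun _ => heisenbergGen .p) := by
  have h := (isNormalOrdering_normalOrder (k := k) 1).map contractOneLeg
  have contract_legGen (g : HeisenbergGen) :
      (contractOneLeg ∘ legGen g : Fin 1 → Heisenberg k) = fun _ => heisenbergGen g :=
    funext fun i => contractOneLeg_tensorLeg i _
  rwa [contract_legGen, contract_legGen] at h

/-- The action of the Weyl–Heisenberg algebra on polynomials, in which `x` acts by multiplication
and `p` acts by differentiation. -/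
def fockAction : Heisenberg k →ₐ[k] Module.End k (Polynomial k) :=
  RingQuot.liftAlgHom k ⟨FreeAlgebra.lift k fun
    | .x => LinearMap.mulLeft k Polynomial.X
    | .p => Polynomial.derivative, by
      rintro _ _ ⟨⟩
      refine LinearMap.ext fun f => ?_
      simp [Polynomial.derivative_mul]⟩

theorem fockAction_x (f : Polynomial k) :
    fockAction (heisenbergGen .x) f = Polynomial.X * f := by
  simp [fockAction, heisenbergGen, RingQuot.liftAlgHom_mkAlgHom_apply]

theorem fockAction_p (f : Polynomial k) :
    fockAction (heisenbergGen .p) f = Polynomial.derivative f := by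
  simp [fockAction, heisenbergGen, RingQuot.liftAlgHom_mkAlgHom_apply]

/-- The vacuum expectation value on the Weyl–Heisenberg algebra: the constant coefficient of the
action on the constant polynomial `1`. -/
def vacuum : Heisenberg k →ₗ[k] k :=
  Polynomial.lcoeff k 0 ∘ₗ LinearMap.applyₗ (1 : Polynomial k) ∘ₗ fockAction.toLinearMap

theorem isVacuumExpectation_vacuum {σ : Type*} :
    IsVacuumExpectation (vacuum (k := k)) (fun _ : σ => heisenbergGen .x)
      (fun _ => heisenbergGen .p) where
  map_one := by simp [vacuum]
  map_x_mul _ b := by simp [vacuum, fockAction_x]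
  map_mul_p _ b := by simp [vacuum, fockAction_p]

theorem eq_algebraMap_vacuum_of_commute [CharZero k] {z : Heisenberg k}
    (h : ∀ g, Commute (heisenbergGen g) z) : z = algebraMap k (Heisenberg k) (vacuum z) := by
  refine isNormalOrdering_contractLegs_one.eq_algebraMap_of_commute isVacuumExpectation_vacuum
    (top_unique ?_) (fun _ => h .x) fun _ => h .p
  rw [← adjoin_range_heisenbergGen]
  exact Algebra.adjoin_mono (by rintro _ ⟨_ | _, rfl⟩ <;> simp)

theorem eq_map_algebraMap_vacuum_of_commute [CharZero k] {z : (Heisenberg k)⟦X⟧}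
    (h : ∀ g, Commute (C (heisenbergGen g)) z) :
    z = PowerSeries.map (algebraMap k (Heisenberg k)) (deform vacuum z) := by
  ext d
  rw [PowerSeries.coeff_map, coeff_deform]
  refine eq_algebraMap_vacuum_of_commute fun g => ?_
  rw [Commute, SemiconjBy, ← PowerSeries.coeff_C_mul, (h g).eq, PowerSeries.coeff_mul_C]

theorem deform_vacuum_gaussian (Q : Matrix (Fin 1) (Fin 1) k⟦X⟧) :
    deform vacuum (deform (contractLegs 1) (gaussian Q)) = 1 := by
  have gaussian_eq : deform (contractLegs 1) (gaussian Q) =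
      deform (contractLegs 1 ∘ₗ normalOrder 1) (hexp (k := k) (quadraticForm (Q - 1))) :=
    deform_deform _ _ _
  rw [gaussian_eq]
  exact isNormalOrdering_contractLegs_one.vacuum_deform_hexp isVacuumExpectation_vacuum

variable [CharZero k]

theorem isGaussian_gaussian {n : ℕ} {Q : Matrix (Fin n) (Fin n) k⟦X⟧}
    (hQ : Q.map constantCoeff = 1) : IsGaussian (legGen .x) (legGen .p) (gaussian Q) Q :=
  (isNormalOrdering_normalOrder n).isGaussian hQ

theorem gaussian_one {n : ℕ} : gaussian (1 : Matrix (Fin n) (Fin n) k⟦X⟧) = 1 :=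
  (isGaussian_gaussian (Matrix.map_one _ (map_zero _) (map_one _))).eq_one

theorem coe_gaussianUnit_inv {n : ℕ} {Q Q' : Matrix (Fin n) (Fin n) k⟦X⟧} (h : Q * Q' = 1)
    (hQ : Q.map constantCoeff = 1) (hQ' : Q'.map constantCoeff = 1) :
    ((gaussianUnit Q)⁻¹ : (HeisenbergPow k n)⟦X⟧ˣ) = gaussian Q' :=
  Units.inv_eq_of_mul_eq_one_right
    (h ▸ (isGaussian_gaussian hQ).mul (isGaussian_gaussian hQ')).eq_one

end WeylHeisenberg

/-! ### Transport of Gaussian elements along a placement of legs -/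

section PlaceMatrix

variable {κ ι : Type*} [Fintype κ] [DecidableEq ι] {R : Type*}

/-- The matrix with the entries of `M` in the rows `r` and the columns `c`, and zeros elsewhere. -/
def placeMatrix [AddCommMonoid R] (r c : κ → ι) (M : Matrix κ κ R) : Matrix ι ι R :=
  ∑ a, ∑ b, Matrix.single (r a) (c b) (M a b)

theorem placeMatrix_add [AddCommMonoid R] (r c : κ → ι) (M N : Matrix κ κ R) :
    placeMatrix r c (M + N) = placeMatrix r c M + placeMatrix r c N := by
  simp [placeMatrix, Matrix.single_add, Finset.sum_add_distrib]

theorem transpose_placeMatrix [AddCommMonoid R] (r c : κ → ι) (M : Matrix κ κ R) :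
    (placeMatrix r c M).transpose = placeMatrix c r M.transpose := by
  simp only [placeMatrix, Matrix.transpose_sum, Matrix.transpose_single, Matrix.transpose_apply]
  exact Finset.sum_comm

variable [Semiring R]

theorem placeMatrix_map {S : Type*} [Semiring S] (f : R →+* S) (r c : κ → ι) (M : Matrix κ κ R) :
    (placeMatrix r c M).map f = placeMatrix r c (M.map f) := by
  ext i j
  simp [placeMatrix, Matrix.sum_apply, Matrix.single_apply, apply_ite f]

theorem placeMatrix_one [DecidableEq κ] (r c : κ → ι) :
    placeMatrix r c (1 : Matrix κ κ R) = ∑ a, Matrix.single (r a) (c a) 1 := by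
  refine Finset.sum_congr rfl fun a _ => ?_
  rw [Finset.sum_eq_single a (fun b _ hb => by simp [Matrix.one_apply_ne hb.symm]) (by simp),
    Matrix.one_apply_eq]

variable [Fintype ι]

theorem placeMatrix_mul_placeMatrix_of_ne {r c r' c' : κ → ι} (h : ∀ a b, c a ≠ r' b)
    (M N : Matrix κ κ R) : placeMatrix r c M * placeMatrix r' c' N = 0 := by
  simp [placeMatrix, Finset.sum_mul, Finset.mul_sum, Matrix.single_mul_single_of_ne, h]

theorem placeMatrix_mul_of_forall_row_eq {r c c' : κ → ι} {S : Matrix ι ι R}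
    (h : ∀ a, S (c a) = Pi.single (c' a) 1) (M : Matrix κ κ R) :
    placeMatrix r c M * S = placeMatrix r c' M := by
  simp only [placeMatrix, Finset.sum_mul]
  refine Finset.sum_congr rfl fun a _ => Finset.sum_congr rfl fun b _ => ?_
  ext i j
  simp [Matrix.mul_apply, Matrix.single_apply, h, Pi.single_apply, ite_and, eq_comm]

theorem diagonal_mul_placeMatrix_mul_diagonal [DecidableEq κ] (d e : ι → R) (r c : κ → ι)
    (M : Matrix κ κ R) :
    Matrix.diagonal d * placeMatrix r c M * Matrix.diagonal e =
      placeMatrix r c (Matrix.diagonal (d ∘ r) * M * Matrix.diagonal (e ∘ c)) := by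
  ext i j
  simp only [Matrix.mul_diagonal, Matrix.diagonal_mul, placeMatrix, Matrix.sum_apply,
    Matrix.single_apply, Finset.mul_sum, Finset.sum_mul, Function.comp_apply]
  refine Finset.sum_congr rfl fun a _ => Finset.sum_congr rfl fun b _ => ?_
  split_ifs with h
  · rw [h.1, h.2]
  · simp

theorem placeMatrix_mulVec (r c : κ → ι) (M : Matrix κ κ R) (v : ι → R) :
    (placeMatrix r c M).mulVec v = ∑ a, Pi.single (r a) (M.mulVec (v ∘ c) a) := by
  have single_mulVec (a b : κ) : (Matrix.single (r a) (c b) (M a b)).mulVec v =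
      Pi.single (r a) (M a b * v (c b)) := Matrix.single_mulVec ..
  simp only [placeMatrix, Matrix.sum_mulVec, single_mulVec]
  exact Finset.sum_congr rfl fun a _ =>
    (map_sum (AddMonoidHom.single (fun _ : ι => R) (r a)) _ _).symm

end PlaceMatrix

section EmbedMatrix

variable {κ ι : Type*} [Fintype κ] [DecidableEq κ] [DecidableEq ι] {R : Type*} [Ring R]

/-- The matrix that acts as `M` on the indices in the image of `s` and trivially on the others. -/
def embedMatrix (s : κ → ι) (M : Matrix κ κ R) : Matrix ι ι R :=
  1 + placeMatrix s s (M - 1)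

theorem transpose_embedMatrix (s : κ → ι) (M : Matrix κ κ R) :
    (embedMatrix s M).transpose = embedMatrix s M.transpose := by
  rw [embedMatrix, Matrix.transpose_add, transpose_placeMatrix, Matrix.transpose_sub,
    Matrix.transpose_one, Matrix.transpose_one, embedMatrix]

@[simp]
theorem embedMatrix_one (s : κ → ι) : embedMatrix s (1 : Matrix κ κ R) = 1 := by
  simp [embedMatrix, placeMatrix]

theorem embedMatrix_map {S : Type*} [Ring S] (f : R →+* S) (s : κ → ι) (M : Matrix κ κ R) :
    (embedMatrix s M).map f = embedMatrix s (M.map f) := by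
  ext i j
  simp [embedMatrix, placeMatrix, Matrix.sum_apply, Matrix.single_apply, Matrix.one_apply,
    apply_ite f]

theorem embedMatrix_apply_left {s : κ → ι} (M : Matrix κ κ R) {i : ι} (hi : i ∉ Set.range s)
    (j : ι) : embedMatrix s M i j = (1 : Matrix ι ι R) i j := by
  have ne (a : κ) : s a ≠ i := fun h => hi ⟨a, h⟩
  simp [embedMatrix, placeMatrix, Matrix.sum_apply, ne]

theorem embedMatrix_apply_right {s : κ → ι} (M : Matrix κ κ R) (i : ι) {j : ι}
    (hj : j ∉ Set.range s) : embedMatrix s M i j = (1 : Matrix ι ι R) i j := by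
  have ne (a : κ) : s a ≠ j := fun h => hj ⟨a, h⟩
  simp [embedMatrix, placeMatrix, Matrix.sum_apply, ne]

theorem embedMatrix_apply_apply {s : κ → ι} (hs : Function.Injective s) (M : Matrix κ κ R)
    (a b : κ) : embedMatrix s M (s a) (s b) = M a b := by
  simp [embedMatrix, placeMatrix, Matrix.sum_apply, Matrix.single_apply, Matrix.one_apply,
    hs.eq_iff, ite_and]

variable [Fintype ι] {V : Type*} [AddCommGroup V] [Module R V]

theorem sum_embedMatrix_apply_smul {s : κ → ι} (hs : Function.Injective s) (M : Matrix κ κ R)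
    (a : κ) (z : ι → V) : ∑ j, embedMatrix s M (s a) j • z j = ∑ b, M a b • z (s b) := by
  refine (Fintype.sum_of_injective s hs _ _ (fun j hj => ?_) fun b => ?_).symm
  · rw [embedMatrix_apply_right M _ hj, Matrix.one_apply_ne fun h => hj ⟨a, h⟩, zero_smul]
  · rw [embedMatrix_apply_apply hs]

theorem sum_embedMatrix_smul_of_notMem_range {s : κ → ι} (M : Matrix κ κ R) {i : ι}
    (hi : i ∉ Set.range s) (z : ι → V) : ∑ j, embedMatrix s M i j • z j = z i := by
  simp [embedMatrix_apply_left M hi, Matrix.one_apply]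

theorem sum_map_embedMatrix_smul {s : κ → ι} (hs : Function.Injective s) (M : Matrix κ κ R)
    (δ : R →+ R) (hδ : δ 1 = 0) (z : ι → ι → V) :
    ∑ i, ∑ j, δ (embedMatrix s M i j) • z i j =
      ∑ a, ∑ b, δ (M a b) • z (s a) (s b) := by
  have map_one_apply (i j : ι) : δ ((1 : Matrix ι ι R) i j) = 0 := by
    simp [Matrix.one_apply, apply_ite δ, hδ]
  refine (Fintype.sum_of_injective s hs _ _ (fun i hi => ?_) fun a => ?_).symm
  · simp [embedMatrix_apply_left M hi, map_one_apply]
  · refine Fintype.sum_of_injective s hs _ _ (fun j hj => ?_) fun b => ?_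
    · rw [embedMatrix_apply_right M _ hj, map_one_apply, zero_smul]
    · rw [embedMatrix_apply_apply hs]

end EmbedMatrix

section MapGaussian

variable {k : Type*} [Field k] {B B' : Type*} [Ring B] [Algebra k B] [Ring B'] [Algebra k B']

theorem hderiv_map (f : B' →+* B) (z : B'⟦X⟧) :
    hderiv (PowerSeries.map f z) = PowerSeries.map f (hderiv z) := by
  ext n
  simp [coeff_hderiv]

theorem map_smul_powerSeries (f : B' →ₐ[k] B) (c : k⟦X⟧) (z : B'⟦X⟧) :
    PowerSeries.map (f : B' →+* B) (c • z) = c • PowerSeries.map (f : B' →+* B) z := by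
  rw [← deform_algHom, ← deform_algHom, deform_smul]

theorem commute_C_map {b : B} {f : B' →+* B} (h : ∀ b', Commute b (f b')) (z : B'⟦X⟧) :
    Commute (C b) (PowerSeries.map f z) := by
  ext n
  simp [(h _).eq]

theorem IsGaussian.map {κ ι : Type*} [Fintype κ] [DecidableEq κ] [Fintype ι] [DecidableEq ι]
    {f : B' →ₐ[k] B} {x p : ι → B} {x' p' : κ → B'} {s : κ → ι} (hs : Function.Injective s)
    (hx : ∀ a, f (x' a) = x (s a)) (hp : ∀ a, f (p' a) = p (s a))
    (hcx : ∀ i ∉ Set.range s, ∀ b, Commute (x i) (f b))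
    (hcp : ∀ i ∉ Set.range s, ∀ b, Commute (p i) (f b)) {b : B'⟦X⟧} {M : Matrix κ κ k⟦X⟧}
    (hb : IsGaussian x' p' b M) :
    IsGaussian x p (PowerSeries.map (f : B' →+* B) b) (embedMatrix s M) where
  constantCoeff_eq := by
    rw [← PowerSeries.coeff_zero_eq_constantCoeff_apply, PowerSeries.coeff_map,
      PowerSeries.coeff_zero_eq_constantCoeff_apply, hb.constantCoeff_eq, map_one]
  constantCoeff_matrix := by
    rw [embedMatrix_map, hb.constantCoeff_matrix, embedMatrix_one]
  mul_x i := by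
    simp only [← Matrix.transpose_apply (embedMatrix s M), transpose_embedMatrix]
    by_cases hi : i ∈ Set.range s
    · obtain ⟨a, rfl⟩ := hi
      simpa [sum_embedMatrix_apply_smul hs, map_smul_powerSeries, hx] using
        congrArg (PowerSeries.map (f : B' →+* B)) (hb.mul_x a)
    · rw [sum_embedMatrix_smul_of_notMem_range _ hi]
      exact (commute_C_map (hcx i hi) b).symm
  p_mul i := by
    by_cases hi : i ∈ Set.range s
    · obtain ⟨a, rfl⟩ := hi
      simpa [sum_embedMatrix_apply_smul hs, map_smul_powerSeries, hp] using
        congrArg (PowerSeries.map (f : B' →+* B)) (hb.p_mul a)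
    · rw [sum_embedMatrix_smul_of_notMem_range _ hi]
      exact commute_C_map (hcp i hi) b
  hderiv_eq := by
    have := sum_map_embedMatrix_smul hs M (d⁄dX k : k⟦X⟧ →+ k⟦X⟧) (by simp)
      fun i j => C (x i) * PowerSeries.map (f : B' →+* B) b * C (p j)
    rw [hderiv_map, hb.hderiv_eq]
    simpa [map_smul_powerSeries, hx, hp] using this.symm

end MapGaussian

/-! ### Determinants and linear systems -/

section Determinants

variable {k R ι : Type*} [CommRing k] [CommRing R] [Algebra k R]

theorem derivation_prod [DecidableEq ι] (δ : Derivation k R R) (s : Finset ι) (f : ι → R) :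
    δ (∏ i ∈ s, f i) = ∑ i ∈ s, δ (f i) * ∏ j ∈ s.erase i, f j := by
  induction s using Finset.induction_on with
  | empty => simp
  | insert a s ha ih =>
    rw [Finset.prod_insert ha, Derivation.leibniz, ih, Finset.sum_insert ha,
      Finset.erase_insert ha, smul_eq_mul, smul_eq_mul, Finset.mul_sum, add_comm, mul_comm]
    refine congrArg _ (Finset.sum_congr rfl fun i hi => ?_)
    rw [Finset.erase_insert_of_ne (ne_of_mem_of_not_mem hi ha).symm,
      Finset.prod_insert fun h => ha (Finset.mem_of_mem_erase h), mul_left_comm]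

variable [Fintype ι]

theorem map_derivation_mul (δ : Derivation k R R) (M : Matrix ι ι R) {N : Matrix ι ι R}
    (hN : N.map δ = 0) : (M * N).map δ = M.map δ * N := by
  have derivation_apply (i j) : δ (N i j) = 0 := congrFun₂ hN i j
  ext i j
  simp [Matrix.mul_apply, derivation_apply, mul_comm]

variable [DecidableEq ι]

theorem derivation_det_eq_sum_det_updateCol (δ : Derivation k R R) (M : Matrix ι ι R) :
    δ M.det = ∑ i, (M.updateCol i fun j => δ (M j i)).det := by
  simp only [Matrix.det_apply, map_sum]
  rw [Finset.sum_comm]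
  refine Finset.sum_congr rfl fun σ _ => ?_
  rw [Units.smul_def, map_zsmul, derivation_prod, Finset.smul_sum]
  refine Finset.sum_congr rfl fun i _ => ?_
  rw [Units.smul_def, ← Finset.mul_prod_erase _ _ (Finset.mem_univ i), Matrix.updateCol_self]
  congr 2
  exact Finset.prod_congr rfl fun j hj => by rw [Matrix.updateCol_ne (Finset.ne_of_mem_erase hj)]

theorem derivation_det (δ : Derivation k R R) (M : Matrix ι ι R) :
    δ M.det = (M.adjugate * M.map δ).trace := by
  rw [derivation_det_eq_sum_det_updateCol]
  refine Finset.sum_congr rfl fun i _ => ?_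
  rw [← Matrix.cramer_apply, Matrix.cramer_eq_adjugate_mulVec]
  rfl

theorem derivation_mul_det_one_sub_mul_eq_zero (δ : Derivation k R R) {P S N : Matrix ι ι R}
    {ω : R} (hS : S.map δ = 0) (hN : N = S * (P * N + ω • 1))
    (hω : δ ω = (P.map δ * N).trace) : δ (ω * (1 - P * S).det) = 0 := by
  set B := 1 - P * S with hB
  have mul_eq : B * (P * N + ω • 1) = ω • 1 := by
    rw [hB, sub_mul, one_mul, mul_assoc, ← hN, add_sub_cancel_left]
  have det_smul_eq : B.det • (P * N + ω • 1) = ω • B.adjugate := by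
    simpa [← mul_assoc, Matrix.adjugate_mul] using congrArg (B.adjugate * ·) mul_eq
  have map_B : B.map δ = -(P.map δ * S) := by
    rw [hB, ← map_derivation_mul δ P hS]
    ext i j
    simp [Matrix.one_apply, apply_ite δ]
  have derivation_det_B : ω * δ B.det = -(B.det * δ ω) :=
    calc ω * δ B.det = -(P.map δ * S * (ω • B.adjugate)).trace := by
          rw [derivation_det, map_B, Matrix.mul_neg, Matrix.trace_neg, Matrix.trace_mul_comm]
          simp
      _ = -(B.det * δ ω) := by
          rw [← det_smul_eq, Matrix.mul_smul, mul_assoc, ← hN, Matrix.trace_smul, hω, smul_eq_mul]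
  rw [Derivation.leibniz, smul_eq_mul, smul_eq_mul, derivation_det_B, neg_add_cancel]

theorem eq_inv_apply_smul_of_sum_smul_eq_single {V : Type*} [AddCommGroup V] [Module R V]
    {M : Matrix ι ι R} (hM : IsUnit M.det) {η : ι → V} {l : ι} {c : V}
    (h : ∀ i, ∑ j, M i j • η j = Pi.single (M := fun _ => V) l c i) (o : ι) :
    η o = M⁻¹ o l • c :=
  calc η o = ∑ j, (M⁻¹ * M) o j • η j := by simp [Matrix.nonsing_inv_mul M hM, Matrix.one_apply]
    _ = ∑ i, M⁻¹ o i • ∑ j, M i j • η j := by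
        simp only [Matrix.mul_apply, Finset.sum_smul, Finset.smul_sum, mul_smul]
        exact Finset.sum_comm
    _ = M⁻¹ o l • c := by simp [h, Pi.single_apply]

theorem inv_apply_of_mulVec_eq_single {M : Matrix ι ι R} (hM : IsUnit M.det) {e : ι → R} {l : ι}
    (h : M.mulVec e = Pi.single l 1) (o : ι) : M⁻¹ o l = e o := by
  rw [← Matrix.one_mulVec e, ← Matrix.nonsing_inv_mul M hM, ← Matrix.mulVec_mulVec, h]
  simp

end Determinants

/-! ### Contraction of Gaussian elements -/

section ShiftMatrix

variable {R : Type*} [CommRing R] {m : ℕ}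

/-- The matrix with ones directly above the diagonal and zeros elsewhere. -/
def shiftMatrix (R : Type*) [CommRing R] (m : ℕ) : Matrix (Fin (m + 1)) (Fin (m + 1)) R :=
  Matrix.of fun i => Fin.cases 0 fun a => if i = a.castSucc then 1 else 0

theorem shiftMatrix_zero (i : Fin (m + 1)) : shiftMatrix R m i 0 = 0 := rfl

theorem shiftMatrix_succ (i : Fin (m + 1)) (a : Fin m) :
    shiftMatrix R m i a.succ = if i = a.castSucc then 1 else 0 := rfl

theorem shiftMatrix_map {R' : Type*} [CommRing R'] (f : R →+* R') :
    (shiftMatrix R m).map f = shiftMatrix R' m := by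
  ext i j
  cases j using Fin.cases <;> simp [shiftMatrix_zero, shiftMatrix_succ, apply_ite f]

theorem shiftMatrix_map_derivation {k : Type*} [CommRing k] [Algebra k R] (δ : Derivation k R R) :
    (shiftMatrix R m).map δ = 0 := by
  ext i j
  cases j using Fin.cases <;> simp [shiftMatrix_zero, shiftMatrix_succ, apply_ite δ]

variable (M : Matrix (Fin (m + 1)) (Fin (m + 1)) R)

theorem mul_shiftMatrix_zero (i : Fin (m + 1)) : (M * shiftMatrix R m) i 0 = 0 := by
  simp [Matrix.mul_apply, shiftMatrix_zero]

theorem mul_shiftMatrix_succ (i : Fin (m + 1)) (a : Fin m) :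
    (M * shiftMatrix R m) i a.succ = M i a.castSucc := by
  simp [Matrix.mul_apply, shiftMatrix_succ]

theorem shiftMatrix_mul_last (j : Fin (m + 1)) : (shiftMatrix R m * M) (Fin.last m) j = 0 := by
  simp [Matrix.mul_apply, Fin.sum_univ_succ, shiftMatrix_zero, shiftMatrix_succ,
    (Fin.castSucc_ne_last _).symm]

theorem shiftMatrix_mul_castSucc (a : Fin m) (j : Fin (m + 1)) :
    (shiftMatrix R m * M) a.castSucc j = M a.succ j := by
  simp [Matrix.mul_apply, Fin.sum_univ_succ, shiftMatrix_zero, shiftMatrix_succ]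

/-- The matrix `1 - Qᵀ S`, where `S` has ones directly above the diagonal.  It governs the
contraction of the legs of a Gaussian element with matrix `Q`. -/
def contractionMatrix (Q : Matrix (Fin (m + 1)) (Fin (m + 1)) R) :
    Matrix (Fin (m + 1)) (Fin (m + 1)) R :=
  1 - Q.transpose * shiftMatrix R m

theorem contractionMatrix_map {R' : Type*} [CommRing R'] (f : R →+* R')
    (Q : Matrix (Fin (m + 1)) (Fin (m + 1)) R) :
    (contractionMatrix Q).map f = contractionMatrix (Q.map f) := by
  simp only [contractionMatrix, ← RingHom.mapMatrix_apply, map_sub, map_mul, map_one]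
  simp only [RingHom.mapMatrix_apply, Matrix.transpose_map, shiftMatrix_map]

theorem det_contractionMatrix_one :
    (contractionMatrix (1 : Matrix (Fin (m + 1)) (Fin (m + 1)) R)).det = 1 := by
  have shiftMatrix_apply {i j : Fin (m + 1)} (h : j ≤ i) : shiftMatrix R m i j = 0 := by
    cases j using Fin.cases with
    | zero => rfl
    | succ a => exact if_neg (a.castSucc_lt_succ.trans_le h).ne'
  rw [contractionMatrix, Matrix.transpose_one, one_mul, Matrix.det_of_isUpperTriangular]
  · simp [shiftMatrix_apply]
  · intro i j (h : j < i)
    simp [shiftMatrix_apply h.le, h.ne']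

theorem map_det_contractionMatrix {R' : Type*} [CommRing R'] {f : R →+* R'}
    {Q : Matrix (Fin (m + 1)) (Fin (m + 1)) R} (hQ : Q.map f = 1) :
    f (contractionMatrix Q).det = 1 := by
  rw [RingHom.map_det, RingHom.mapMatrix_apply, contractionMatrix_map, hQ,
    det_contractionMatrix_one]

section Smul

variable {V : Type*} [AddCommGroup V] [Module R V] (Q : Matrix (Fin (m + 1)) (Fin (m + 1)) R)
  (η : Fin (m + 1) → V)

theorem sum_contractionMatrix_smul (i : Fin (m + 1)) :
    ∑ j, contractionMatrix Q i j • η j = η i - ∑ a : Fin m, Q a.castSucc i • η a.succ := by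
  simp only [contractionMatrix, Matrix.sub_apply, sub_smul, Finset.sum_sub_distrib]
  congr 1
  · simp [Matrix.one_apply]
  · simp [Fin.sum_univ_succ, mul_shiftMatrix_zero, mul_shiftMatrix_succ]

theorem sum_contractionMatrix_transpose_zero_smul :
    ∑ j, (contractionMatrix Q).transpose 0 j • η j = η 0 := by
  simp [contractionMatrix, Matrix.one_apply, mul_shiftMatrix_zero]

theorem sum_contractionMatrix_transpose_succ_smul (a : Fin m) :
    ∑ j, (contractionMatrix Q).transpose a.succ j • η j =
      η a.succ - ∑ j, Q a.castSucc j • η j := by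
  simp [contractionMatrix, sub_smul, Matrix.one_apply, mul_shiftMatrix_succ]

end Smul

end ShiftMatrix

section Contraction

variable {k : Type*} [Field k] {A B : Type*} [Ring A] [Algebra k A] [Ring B] [Algebra k B] {m : ℕ}

/-- `F` is compatible with moving the copies `Y i` of `y` along the legs `0, 1, …, m`, where the
legs are multiplied from right to left. -/
structure IsContraction (F : B →ₗ[k] A) (y : A) (Y : Fin (m + 1) → B) : Prop where
  castSucc_mul : ∀ (i : Fin m) b, F (Y i.castSucc * b) = F (b * Y i.succ)
  last_mul : ∀ b, F (Y (Fin.last m) * b) = y * F b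
  mul_zero : ∀ b, F (b * Y 0) = F b * y

theorem isContraction_contractLegs (y : A) :
    IsContraction (contractLegs (k := k) (m + 1)) y fun i => tensorLeg i y where
  castSucc_mul i := contractLegs_castSucc_mul i y
  last_mul := contractLegs_last_mul y
  mul_zero := contractLegs_mul_zero y

namespace IsContraction

variable {F : B →ₗ[k] A} {y : A} {Y : Fin (m + 1) → B} (h : IsContraction F y Y) (z : B⟦X⟧)
include h

theorem deform_castSucc_mul (i : Fin m) :
    deform F (C (Y i.castSucc) * z) = deform F (z * C (Y i.succ)) := by
  ext; simp [h.castSucc_mul]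

theorem deform_last_mul : deform F (C (Y (Fin.last m)) * z) = C y * deform F z := by
  ext; simp [h.last_mul]

theorem deform_mul_zero : deform F (z * C (Y 0)) = deform F z * C y := by
  ext; simp [h.mul_zero]

end IsContraction

namespace IsGaussian

variable {F : B →ₗ[k] A} {x p : A} {xs ps : Fin (m + 1) → B} {b : B⟦X⟧}
  {Q : Matrix (Fin (m + 1)) (Fin (m + 1)) k⟦X⟧}

theorem isUnit_det_contractionMatrix (hb : IsGaussian xs ps b Q) :
    IsUnit (contractionMatrix Q).det := by
  rw [PowerSeries.isUnit_iff_constantCoeff, map_det_contractionMatrix hb.constantCoeff_matrix]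
  exact isUnit_one

theorem commute_p_deform (hb : IsGaussian xs ps b Q) (hp : IsContraction F p ps)
    (hlast : Q (Fin.last m) = Pi.single (Fin.last m) 1)
    (hinv : (contractionMatrix Q)⁻¹ 0 (Fin.last m) = 1) : Commute (C p) (deform F b) := by
  have deform_p_mul (i) : deform F (C (ps i) * b) = ∑ j, Q i j • deform F (b * C (ps j)) := by
    rw [hb.p_mul, deform_sum]
    simp only [deform_smul]
  have system (i) : ∑ j, (contractionMatrix Q).transpose i j • deform F (b * C (ps j)) =
      Pi.single (M := fun _ => A⟦X⟧) 0 (deform F b * C p) i := by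
    cases i using Fin.cases with
    | zero => rw [sum_contractionMatrix_transpose_zero_smul, hp.deform_mul_zero, Pi.single_eq_same]
    | succ a =>
      rw [sum_contractionMatrix_transpose_succ_smul, ← deform_p_mul, hp.deform_castSucc_mul,
        sub_self, Pi.single_eq_of_ne a.succ_ne_zero]
  have isUnit_det : IsUnit (contractionMatrix Q).transpose.det := by
    rw [Matrix.det_transpose]
    exact hb.isUnit_det_contractionMatrix
  have solution := eq_inv_apply_smul_of_sum_smul_eq_single isUnit_det system (Fin.last m)
  rw [← Matrix.transpose_nonsing_inv, Matrix.transpose_apply, hinv, one_smul] at solution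
  rw [Commute, SemiconjBy, ← hp.deform_last_mul, deform_p_mul, hlast, ← solution]
  simp [Pi.single_apply]

theorem commute_x_deform (hb : IsGaussian xs ps b Q) (hx : IsContraction F x xs)
    (hlast : Q (Fin.last m) = Pi.single (Fin.last m) 1)
    (hinv : (contractionMatrix Q)⁻¹ 0 (Fin.last m) = 1) : Commute (C x) (deform F b) := by
  have system (i) : ∑ j, contractionMatrix Q i j • deform F (b * C (xs j)) =
      Pi.single (M := fun _ => A⟦X⟧) (Fin.last m) (C x * deform F b) i := by
    rw [sum_contractionMatrix_smul, hb.mul_x, deform_sum, Fin.sum_univ_castSucc]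
    simp only [deform_smul, hx.deform_castSucc_mul, add_sub_cancel_left, hlast]
    obtain rfl | h := eq_or_ne i (Fin.last m)
    · simp only [Pi.single_eq_same, one_smul, hx.deform_last_mul]
    · simp only [Pi.single_eq_of_ne h, zero_smul]
  have solution :=
    eq_inv_apply_smul_of_sum_smul_eq_single hb.isUnit_det_contractionMatrix system 0
  rw [hinv, one_smul, hx.deform_mul_zero] at solution
  exact solution.symm

end IsGaussian

end Contraction

section ContractionVacuum

variable {k : Type*} [Field k] {A B : Type*} [Ring A] [Algebra k A] [Ring B] [Algebra k B] {m : ℕ}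
  {F : B →ₗ[k] A} {x : A} {xs ps : Fin (m + 1) → B} {v : A →ₗ[k] k}

namespace IsGaussian

variable {b : B⟦X⟧} {Q : Matrix (Fin (m + 1)) (Fin (m + 1)) k⟦X⟧}

/-- The matrix with the values of the functional `v` on the elements `x i * b * p j`. -/
def momentMatrix (v : B →ₗ[k] k) (xs ps : Fin (m + 1) → B) (b : B⟦X⟧) :
    Matrix (Fin (m + 1)) (Fin (m + 1)) k⟦X⟧ :=
  Matrix.of fun i j => deform v (C (xs i) * b * C (ps j))

theorem transpose_mul_momentMatrix_apply (hb : IsGaussian xs ps b Q) (v : B →ₗ[k] k) (i j) :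
    (Q.transpose * momentMatrix v xs ps b) i j = deform v (b * C (xs i) * C (ps j)) := by
  rw [hb.mul_x, Finset.sum_mul, deform_sum]
  simp [Matrix.mul_apply, momentMatrix, deform_functional_smul]

theorem derivative_functional (hb : IsGaussian xs ps b Q) (v : B →ₗ[k] k) :
    d⁄dX k (deform v b) = ((Q.transpose.map (d⁄dX k)) * momentMatrix v xs ps b).trace := by
  calc d⁄dX k (deform v b) = deform v (hderiv b) := by
        rw [deform_hderiv, hderiv_eq_derivative (k := k)]; rfl
    _ = ∑ i, ∑ j, d⁄dX k (Q i j) * momentMatrix v xs ps b i j := by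
        rw [hb.hderiv_eq]
        simp only [deform_sum, deform_functional_smul, momentMatrix, Matrix.of_apply]
    _ = ((Q.transpose.map (d⁄dX k)) * momentMatrix v xs ps b).trace := by
        simp only [Matrix.trace, Matrix.diag_apply, Matrix.mul_apply, Matrix.map_apply,
          Matrix.transpose_apply]
        exact Finset.sum_comm

theorem momentMatrix_comp (hb : IsGaussian xs ps b Q) (hx : IsContraction F x xs)
    (hcomm : ∀ i j, ps i * xs j = xs j * ps i + if i = j then 1 else 0)
    (hv : ∀ a, v (x * a) = 0) :
    momentMatrix (v ∘ₗ F) xs ps b =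
      shiftMatrix k⟦X⟧ m * (Q.transpose * momentMatrix (v ∘ₗ F) xs ps b +
        deform (v ∘ₗ F) b • 1) := by
  have mul_x_mul_p (i j) : b * C (ps j) * C (xs i) =
      b * C (xs i) * C (ps j) + if j = i then b else 0 := by
    rw [mul_assoc, ← map_mul, hcomm, map_add, map_mul, mul_add, ← mul_assoc]
    split_ifs <;> simp
  ext1 i j
  cases i using Fin.lastCases with
  | last =>
    rw [shiftMatrix_mul_last, momentMatrix, Matrix.of_apply, mul_assoc]
    ext d
    simp [hx.last_mul, hv]
  | cast a =>
    have deform_comp_castSucc_mul (z) : deform (v ∘ₗ F) (C (xs a.castSucc) * z) =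
        deform (v ∘ₗ F) (z * C (xs a.succ)) := by
      ext d
      simp [hx.castSucc_mul]
    rw [shiftMatrix_mul_castSucc, Matrix.add_apply, hb.transpose_mul_momentMatrix_apply,
      momentMatrix, Matrix.of_apply, mul_assoc, deform_comp_castSucc_mul, mul_x_mul_p, deform_add]
    ext d
    split_ifs with h <;> simp [h, eq_comm (a := a.succ)]

variable [CharZero k]

theorem functional_mul_det_contractionMatrix (hb : IsGaussian xs ps b Q)
    (hx : IsContraction F x xs)
    (hcomm : ∀ i j, ps i * xs j = xs j * ps i + if i = j then 1 else 0)
    (hv : ∀ a, v (x * a) = 0) (hv_one : v (F 1) = 1) :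
    deform v (deform F b) * (contractionMatrix Q).det = 1 := by
  rw [deform_deform]
  refine PowerSeries.derivative.ext ?_ ?_
  · rw [Derivation.map_one_eq_zero, contractionMatrix]
    exact derivation_mul_det_one_sub_mul_eq_zero (d⁄dX k) (shiftMatrix_map_derivation _)
      (hb.momentMatrix_comp hx hcomm hv) (hb.derivative_functional _)
  · rw [map_mul, map_det_contractionMatrix hb.constantCoeff_matrix]
    rw [← PowerSeries.coeff_zero_eq_constantCoeff_apply, coeff_deform,
      PowerSeries.coeff_zero_eq_constantCoeff_apply, hb.constantCoeff_eq]
    simp [hv_one]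

end IsGaussian

end ContractionVacuum

/-! ### The Alexander numbering of the edges of a diagram -/

section AlexanderNumbering

/-- The orientation sign of a strand: crossing an upward strand from left to right lowers the
Alexander index of a region by one, crossing a downward strand raises it by one. -/
def Strand.sign (s : Strand) : ℤ := if s.up then 1 else -1

/-- The Alexander index of the region to the right of a word of strands, if the region to its left
has index zero. -/
def rightLevel (w : List Strand) : ℤ := -(w.map Strand.sign).sum

/-- The strands of a word that have a given orientation.  Each edge comes with its level: the
Alexander index of the region to its left with respect to the orientation of the strand, if the
leftmost region has index `c`. -/
def strandLevels (up : Bool) : ℤ → List Strand → Multiset (ℕ × ℤ)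
  | _, [] => 0
  | c, s :: w =>
      (if s.up = up then {(s.edge, if up then c else c + 1)} else 0) +
        strandLevels up (c - s.sign) w

theorem strandLevels_append (up : Bool) (c : ℤ) (l r : List Strand) :
    strandLevels up c (l ++ r) = strandLevels up c l + strandLevels up (c + rightLevel l) r := by
  induction l generalizing c with
  | nil => simp [strandLevels, rightLevel]
  | cons s l ih =>
    have level_eq : c - s.sign + rightLevel l = c + rightLevel (s :: l) := by
      simp only [rightLevel, List.map_cons, List.sum_cons]
      ring
    rw [List.cons_append, strandLevels, ih, strandLevels, level_eq, add_assoc]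

/-- The incoming strands of crossings with levels, where the level of a crossing is that of its
incoming over-strand. -/
def incomingStrands (L : Multiset (Crossing × ℤ)) : Multiset (ℕ × ℤ) :=
  L.bind fun q => {(q.1.overEdge, q.2)} + {(q.1.underEdge, q.2 - q.1.sign)}

/-- The outgoing strands of crossings with levels, where the level of a crossing is that of its
incoming over-strand. -/
def outgoingStrands (L : Multiset (Crossing × ℤ)) : Multiset (ℕ × ℤ) :=
  L.bind fun q => {(q.1.underEdge + 1, q.2)} + {(q.1.overEdge + 1, q.2 - q.1.sign)}

theorem incomingStrands_cons (q : Crossing × ℤ) (L : Multiset (Crossing × ℤ)) :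
    incomingStrands (q ::ₘ L) =
      {(q.1.overEdge, q.2)} + {(q.1.underEdge, q.2 - q.1.sign)} + incomingStrands L :=
  Multiset.cons_bind _ _ _

theorem outgoingStrands_cons (q : Crossing × ℤ) (L : Multiset (Crossing × ℤ)) :
    outgoingStrands (q ::ₘ L) =
      {(q.1.underEdge + 1, q.2)} + {(q.1.overEdge + 1, q.2 - q.1.sign)} + outgoingStrands L :=
  Multiset.cons_bind _ _ _

theorem map_fst_outgoingStrands (L : Multiset (Crossing × ℤ)) :
    (outgoingStrands L).map Prod.fst = ((incomingStrands L).map Prod.fst).map (· + 1) := by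
  simp [outgoingStrands, incomingStrands, add_comm]

namespace UpwardTangle

/-- The crossings of a diagram, each with the level of its incoming over-strand. -/
def leveledCrossings : {w : List Strand} → UpwardTangle w → Multiset (Crossing × ℤ)
  | _, start => 0
  | _, @crossing pos l _ a b _ _ d =>
      (if pos then (⟨pos, a, b⟩, rightLevel l) else (⟨pos, b, a⟩, rightLevel l - 1)) ::ₘ
        leveledCrossings d
  | _, maxLeft d => leveledCrossings d
  | _, maxRight d => leveledCrossings d
  | _, minRight _ _ d => leveledCrossings d
  | _, minLeft _ _ d => leveledCrossings d

theorem map_fst_leveledCrossings {w : List Strand} (d : UpwardTangle w) :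
    d.leveledCrossings.map Prod.fst = d.crossings := by
  induction d with
  | start => rfl
  | crossing pos d ih => cases pos <;> simp [leveledCrossings, crossings, ih]
  | _ => assumption

theorem strand_balance {w : List Strand} (d : UpwardTangle w) :
    {(0, 0)} + outgoingStrands d.leveledCrossings + strandLevels false 0 w =
      incomingStrands d.leveledCrossings + strandLevels true 0 w := by
  induction d with
  | start => simp [leveledCrossings, outgoingStrands, incomingStrands, strandLevels]
  | @crossing pos l r a b u v d ih =>
    simp only [leveledCrossings, incomingStrands_cons, outgoingStrands_cons, strandLevels_append,
      strandLevels, Strand.sign] at ih ⊢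
    cases pos <;>
    · simp only [Crossing.sign]
      grind
  | @maxLeft l r a u d ih =>
    simp only [leveledCrossings, strandLevels_append, strandLevels, Strand.sign] at ih ⊢
    apply add_left_cancel (a := {(a, rightLevel l + 1)})
    grind
  | @maxRight l r a u d ih =>
    simp only [leveledCrossings, strandLevels_append, strandLevels, Strand.sign] at ih ⊢
    apply add_left_cancel (a := {(a, rightLevel l)})
    grind
  | @minRight l r a u d ih =>
    simp only [leveledCrossings, strandLevels_append, strandLevels, Strand.sign] at ih ⊢
    grind
  | @minLeft l r a u d ih =>
    simp only [leveledCrossings, strandLevels_append, strandLevels, Strand.sign] at ih ⊢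
    grind

end UpwardTangle

theorem eq_range_of_zero_add_map_succ_eq_add {E : Multiset ℕ} {n : ℕ}
    (h : {0} + E.map (· + 1) = E + {n}) : E = Multiset.range n := by
  have count_eq (e : ℕ) : E.count e = if e < n then 1 else 0 := by
    induction e with
    | zero =>
      have count_zero := congrArg (Multiset.count 0) h
      have map_succ : Multiset.count 0 (E.map (· + 1)) = 0 := Multiset.count_eq_zero.2 (by simp)
      rw [Multiset.count_add, Multiset.count_add, map_succ, Multiset.count_singleton,
        Multiset.count_singleton] at count_zero
      grind
    | succ e ih =>
      have count_succ := congrArg (Multiset.count (e + 1)) h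
      rw [Multiset.count_add, Multiset.count_add,
        Multiset.count_map_eq_count' _ _ (add_left_injective 1), Multiset.count_singleton,
        Multiset.count_singleton, ih] at count_succ
      grind
  ext e
  rw [count_eq, Multiset.count_eq_of_nodup (Multiset.nodup_range n)]
  simp only [Multiset.mem_range]

theorem exists_forall_mem_apply_fst_eq_snd {α β : Type*} [Nonempty β] {s : Multiset (α × β)}
    (hs : (s.map Prod.fst).Nodup) : ∃ f : α → β, ∀ q ∈ s, f q.1 = q.2 := by
  obtain rfl | ⟨q₀, -⟩ := s.empty_or_exists_mem
  · exact ⟨fun _ => Classical.arbitrary β, by simp⟩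
  have : Nonempty (α × β) := ⟨q₀⟩
  have fst_injOn : Set.InjOn Prod.fst {q | q ∈ s} :=
    fun _ hp _ hq => Multiset.inj_on_of_nodup_map hs _ hp _ hq
  exact ⟨Prod.snd ∘ Function.invFunOn Prod.fst {q | q ∈ s},
    fun q hq => congrArg Prod.snd (fst_injOn.leftInvOn_invFunOn hq)⟩

/-- The incoming edges of a crossing, first that of the over-strand. -/
def Crossing.incomingEdge (c : Crossing) : Fin 2 → ℕ := ![c.overEdge, c.underEdge]

/-- The incoming edges of the crossings in a list. -/
def incomingEdges (cs : List Crossing) : List ℕ :=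
  cs.flatMap fun c => List.ofFn c.incomingEdge

theorem incomingEdges_cons (c : Crossing) (cs : List Crossing) :
    incomingEdges (c :: cs) = List.ofFn c.incomingEdge ++ incomingEdges cs :=
  List.flatMap_cons

theorem map_fst_incomingStrands {L : Multiset (Crossing × ℤ)} {cs : List Crossing}
    (h : L.map Prod.fst = cs) : (incomingStrands L).map Prod.fst = incomingEdges cs := by
  rw [incomingEdges, ← Multiset.coe_bind, ← h, Multiset.bind_map, incomingStrands,
    Multiset.map_bind]
  rfl

namespace UpwardKnotDiagram

variable (D : UpwardKnotDiagram)

/-- An Alexander numbering of the edges of `D`: each edge is labelled by the index of the region to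
its left, where the index drops by one across an edge. -/
structure IsAlexanderNumbering (μ : ℕ → ℤ) : Prop where
  first : μ 0 = 0
  last : μ D.lastEdge = 0
  underEdge_succ : ∀ c ∈ D.tangle.crossings, μ (c.underEdge + 1) = μ c.overEdge
  overEdge_succ : ∀ c ∈ D.tangle.crossings, μ (c.overEdge + 1) = μ c.underEdge
  sub_eq_sign : ∀ c ∈ D.tangle.crossings, μ c.overEdge - μ c.underEdge = c.sign

theorem zero_add_outgoingStrands_eq :
    {(0, 0)} + outgoingStrands D.tangle.leveledCrossings =
      incomingStrands D.tangle.leveledCrossings + {(D.lastEdge, 0)} := by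
  simpa [strandLevels] using D.tangle.strand_balance

theorem map_fst_incomingStrands_leveledCrossings :
    (incomingStrands D.tangle.leveledCrossings).map Prod.fst = Multiset.range D.lastEdge := by
  apply eq_range_of_zero_add_map_succ_eq_add
  simpa only [Multiset.map_add, Multiset.map_singleton, map_fst_outgoingStrands] using
    congrArg (Multiset.map Prod.fst) D.zero_add_outgoingStrands_eq

theorem incomingEdges_perm_range :
    (incomingEdges D.tangle.crossings).Perm (List.range D.lastEdge) := by
  rw [← Multiset.coe_eq_coe, ← map_fst_incomingStrands D.tangle.map_fst_leveledCrossings,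
    D.map_fst_incomingStrands_leveledCrossings, Multiset.range]

theorem exists_isAlexanderNumbering : ∃ μ, D.IsAlexanderNumbering μ := by
  set L := D.tangle.leveledCrossings
  have nodup : ((incomingStrands L + {(D.lastEdge, (0 : ℤ))}).map Prod.fst).Nodup := by
    rw [Multiset.map_add, D.map_fst_incomingStrands_leveledCrossings, Multiset.map_singleton,
      add_comm, Multiset.singleton_add, ← Multiset.range_succ]
    exact Multiset.nodup_range _
  obtain ⟨μ, hμ⟩ := exists_forall_mem_apply_fst_eq_snd nodup
  have hμ_out : ∀ q ∈ {(0, 0)} + outgoingStrands L, μ q.1 = q.2 := by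
    rwa [D.zero_add_outgoingStrands_eq]
  have level_eq : ∀ c ∈ D.tangle.crossings, ∃ n : ℤ, μ c.overEdge = n ∧
      μ c.underEdge = n - c.sign ∧ μ (c.underEdge + 1) = n ∧ μ (c.overEdge + 1) = n - c.sign := by
    intro c hc
    rw [← Multiset.mem_coe, ← D.tangle.map_fst_leveledCrossings, Multiset.mem_map] at hc
    obtain ⟨q, hq, rfl⟩ := hc
    have incoming_eq {p : ℕ × ℤ}
        (hp : p ∈ ({(q.1.overEdge, q.2)} + {(q.1.underEdge, q.2 - q.1.sign)} : Multiset _)) :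
        μ p.1 = p.2 :=
      hμ p (Multiset.mem_add.2 (Or.inl (Multiset.mem_bind.2 ⟨q, hq, hp⟩)))
    have outgoing_eq {p : ℕ × ℤ} (hp : p ∈
        ({(q.1.underEdge + 1, q.2)} + {(q.1.overEdge + 1, q.2 - q.1.sign)} : Multiset _)) :
        μ p.1 = p.2 :=
      hμ_out p (Multiset.mem_add.2 (Or.inr (Multiset.mem_bind.2 ⟨q, hq, hp⟩)))
    exact ⟨q.2, incoming_eq (p := (_, _)) (by simp), incoming_eq (p := (_, _)) (by simp),
      outgoing_eq (p := (_, _)) (by simp), outgoing_eq (p := (_, _)) (by simp)⟩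
  refine ⟨μ, ⟨hμ_out (0, 0) (by simp), hμ (D.lastEdge, 0) (by simp), ?_, ?_, ?_⟩⟩ <;> grind

end UpwardKnotDiagram

end AlexanderNumbering

/-! ### Beads and contraction matrices of diagrams -/

theorem prod_eq_one_add_sum_sub_one {R : Type*} [Ring R] {l : List R}
    (h : l.Pairwise fun a b => (a - 1) * (b - 1) = 0) : l.prod = 1 + (l.map (· - 1)).sum := by
  induction l with
  | nil => simp
  | cons a l ih =>
    obtain ⟨ha, hl⟩ := List.pairwise_cons.1 h
    have mul_sum_eq_zero : (a - 1) * (l.map (· - 1)).sum = 0 := by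
      rw [← List.sum_map_mul_left]
      exact List.sum_eq_zero (by simpa using ha)
    rw [sub_one_mul, sub_eq_zero] at mul_sum_eq_zero
    rw [List.prod_cons, ih hl, mul_add, mul_one, mul_sum_eq_zero, List.map_cons, List.sum_cons]
    abel

namespace UpwardKnotDiagram

variable (D : UpwardKnotDiagram)

theorem edge_castSucc (e : Fin D.lastEdge) : D.edge e = e.castSucc := by
  ext
  simp [edge, Fin.ofNat, Nat.mod_eq_of_lt (Nat.lt_succ_of_lt e.2)]

theorem edge_succ (e : Fin D.lastEdge) : D.edge (e + 1) = e.succ := by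
  ext
  simp [edge, Fin.ofNat, Nat.mod_eq_of_lt (Nat.succ_lt_succ e.2)]

theorem nodup_incomingEdges : (incomingEdges D.tangle.crossings).Nodup :=
  D.incomingEdges_perm_range.nodup_iff.2 List.nodup_range

/-- The incoming edges of a crossing, as edges of `D`. -/
def inLegs (c : Crossing) (a : Fin 2) : D.Edge := D.edge (c.incomingEdge a)

/-- The outgoing edges of a crossing, as edges of `D`. -/
def outLegs (c : Crossing) (a : Fin 2) : D.Edge := D.edge (c.incomingEdge a + 1)

variable {D} {c : Crossing}

theorem exists_eq_incomingEdge (hc : c ∈ D.tangle.crossings) (a : Fin 2) :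
    ∃ e : Fin D.lastEdge, c.incomingEdge a = e ∧ D.inLegs c a = e.castSucc ∧
      D.outLegs c a = e.succ := by
  have lt : c.incomingEdge a < D.lastEdge := List.mem_range.1
    (D.incomingEdges_perm_range.subset (List.mem_flatMap.2 ⟨c, hc, List.mem_ofFn.2 ⟨a, rfl⟩⟩))
  exact ⟨⟨_, lt⟩, rfl, D.edge_castSucc ⟨_, lt⟩, D.edge_succ ⟨_, lt⟩⟩

theorem inLegs_eq_inLegs {c' : Crossing} (hc : c ∈ D.tangle.crossings)
    (hc' : c' ∈ D.tangle.crossings) {a b : Fin 2} :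
    D.inLegs c a = D.inLegs c' b ↔ c.incomingEdge a = c'.incomingEdge b := by
  obtain ⟨e, he, he_in, -⟩ := exists_eq_incomingEdge hc a
  obtain ⟨e', he', he_in', -⟩ := exists_eq_incomingEdge hc' b
  rw [he, he', he_in, he_in', Fin.castSucc_inj, Fin.ext_iff]

theorem inLegs_injective (hc : c ∈ D.tangle.crossings) : Function.Injective (D.inLegs c) :=
  fun _ _ h => List.nodup_ofFn.1 ((List.nodup_flatMap.1 D.nodup_incomingEdges).1 c hc)
    ((inLegs_eq_inLegs hc hc).1 h)

theorem inLegs_ne_last (hc : c ∈ D.tangle.crossings) (a : Fin 2) :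
    D.inLegs c a ≠ Fin.last D.lastEdge := by
  obtain ⟨e, -, he, -⟩ := exists_eq_incomingEdge hc a
  exact he.trans_ne (Fin.castSucc_ne_last e)

variable (D)

theorem pairwise_inLegs_ne :
    D.tangle.crossings.Pairwise fun c c' => ∀ a b, D.inLegs c a ≠ D.inLegs c' b :=
  (List.nodup_flatMap.1 D.nodup_incomingEdges).2.imp_of_mem fun hc hc' disjoint a b h =>
    disjoint (List.mem_ofFn.2 ⟨a, rfl⟩)
      (List.mem_ofFn.2 ⟨b, ((inLegs_eq_inLegs hc hc').1 h).symm⟩)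

theorem sum_crossings {V : Type*} [AddCommMonoid V] (f : D.Edge → D.Edge → V) :
    (D.tangle.crossings.map fun c => ∑ a, f (D.inLegs c a) (D.outLegs c a)).sum =
      ∑ e : Fin D.lastEdge, f e.castSucc e.succ := by
  have sum_incomingEdges (cs : List Crossing) :
      (cs.map fun c => ∑ a, f (D.inLegs c a) (D.outLegs c a)).sum =
        ((incomingEdges cs).map fun e => f (D.edge e) (D.edge (e + 1))).sum := by
    induction cs with
    | nil => rfl
    | cons c cs ih =>
      rw [List.map_cons, List.sum_cons, ih, incomingEdges_cons, List.map_append, List.sum_append,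
        List.map_ofFn, List.sum_ofFn]
      rfl
  rw [sum_incomingEdges, (D.incomingEdges_perm_range.map _).sum_eq]
  simp only [← edge_castSucc, ← edge_succ]
  exact (Fin.sum_univ_eq_sum_range (fun e => f (D.edge e) (D.edge (e + 1))) D.lastEdge).symm

end UpwardKnotDiagram

section CrossingMatrices

variable {R : Type*} [CommRing R]

/-- The matrix `Q` with `R = φ(Q)` if `u = T`, and with `R⁻¹ = φ(Q)` if `u = T⁻¹`. -/
def crossingGaussianMatrix (u : Rˣ) : Matrix (Fin 2) (Fin 2) R :=
  !![(u : R), 0; 1 - (u : R) ^ 2, u]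

theorem crossingGaussianMatrix_mul_inv (u : Rˣ) :
    crossingGaussianMatrix u * crossingGaussianMatrix u⁻¹ = 1 := by
  have mul_inv := u.mul_inv
  rw [crossingGaussianMatrix, crossingGaussianMatrix, Matrix.mul_fin_two, Matrix.one_fin_two]
  congr! 4 <;> grind

/-- The block of the Alexander matrix that belongs to a crossing, up to sign, with `T ^ s`
replaced by `v`. -/
def crossingAlexanderMatrix (v : R) : Matrix (Fin 2) (Fin 2) R := !![v, 1 - v; 0, 1]

theorem crossingAlexanderMatrix_map {S : Type*} [CommRing S] (f : R →+* S) (v : R) :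
    (crossingAlexanderMatrix v).map f = crossingAlexanderMatrix (f v) := by
  ext i j
  fin_cases i <;> fin_cases j <;> simp [crossingAlexanderMatrix]

theorem crossingAlexanderMatrix_mulVec_one (v : R) :
    (crossingAlexanderMatrix v).mulVec 1 = 1 := by
  ext i
  fin_cases i <;> simp [crossingAlexanderMatrix, Matrix.mulVec, dotProduct]

theorem diagonal_mul_crossingAlexanderMatrix_mul_diagonal (u d : Rˣ) :
    Matrix.diagonal ![(↑(d * u)⁻¹ : R), ↑d⁻¹] * crossingAlexanderMatrix ((u : R) ^ 2) *
        Matrix.diagonal ![(d : R), ↑(d * u)] =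
      (crossingGaussianMatrix u).transpose := by
  have mul_inv_d := d.mul_inv
  have mul_inv_u := u.mul_inv
  ext i j
  fin_cases i <;> fin_cases j <;>
    simp [crossingGaussianMatrix, crossingAlexanderMatrix, Matrix.diagonal_mul,
      Matrix.mul_diagonal] <;>
    grind

end CrossingMatrices

namespace UpwardKnotDiagram

variable (D : UpwardKnotDiagram) {R : Type*} [CommRing R]

theorem crossingMatrix_eq_neg_placeMatrix (c : Crossing) :
    D.crossingMatrix c = -placeMatrix (D.inLegs c) (D.outLegs c)
      (crossingAlexanderMatrix (LaurentPolynomial.T c.sign)) := by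
  refine Matrix.ext fun i j => ?_
  simp only [crossingMatrix, placeMatrix, crossingAlexanderMatrix, inLegs, outLegs,
    Crossing.incomingEdge, Fin.sum_univ_two, Matrix.add_apply, Matrix.neg_apply,
    Matrix.single_apply, Matrix.of_apply, Matrix.cons_val_zero, Matrix.cons_val_one,
    Matrix.cons_val_fin_one, ite_self]
  split_ifs <;> ring

theorem alexanderMatrix_eq : D.alexanderMatrix = 1 - (D.tangle.crossings.map fun c =>
    placeMatrix (D.inLegs c) (D.outLegs c)
      (crossingAlexanderMatrix (LaurentPolynomial.T c.sign))).sum := by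
  rw [alexanderMatrix, funext D.crossingMatrix_eq_neg_placeMatrix, sub_eq_add_neg]
  congr 1
  exact ((map_list_sum negAddMonoidHom _).trans (congrArg List.sum (List.map_map ..))).symm

/-- The evaluation of Laurent polynomials at `T²`. -/
def evalSq (T : Rˣ) : LaurentPolynomial ℤ →+* R :=
  LaurentPolynomial.eval₂ (Int.castRingHom R) (T ^ 2)

theorem evalSq_T (T : Rˣ) (n : ℤ) : evalSq T (LaurentPolynomial.T n) = (↑(T ^ n) : R) ^ 2 := by
  rw [evalSq, LaurentPolynomial.eval₂_T, ← Units.val_pow_eq_pow_val, ← zpow_natCast,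
    ← zpow_natCast, ← zpow_mul, ← zpow_mul, mul_comm]

theorem alexanderMatrix_map_evalSq (T : Rˣ) :
    D.alexanderMatrix.map (evalSq T) = 1 - (D.tangle.crossings.map fun c =>
      placeMatrix (D.inLegs c) (D.outLegs c)
        (crossingAlexanderMatrix ((↑(T ^ c.sign) : R) ^ 2))).sum := by
  rw [alexanderMatrix_eq, ← RingHom.mapMatrix_apply, map_sub, map_one, map_list_sum, List.map_map]
  simp only [Function.comp_def, RingHom.mapMatrix_apply, placeMatrix_map,
    crossingAlexanderMatrix_map, evalSq_T]

theorem alexanderMatrix_mulVec_one :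
    D.alexanderMatrix.mulVec 1 = Pi.single (Fin.last D.lastEdge) 1 := by
  have crossing_mulVec (c : Crossing) :
      (placeMatrix (D.inLegs c) (D.outLegs c)
        (crossingAlexanderMatrix (LaurentPolynomial.T (R := ℤ) c.sign))).mulVec 1 =
      ∑ a, Pi.single (D.inLegs c a) 1 := by
    rw [placeMatrix_mulVec, Pi.one_comp, crossingAlexanderMatrix_mulVec_one]
    rfl
  have sum_mulVec := (map_list_sum (Matrix.mulVec.addMonoidHomLeft 1) (D.tangle.crossings.map
    fun c => placeMatrix (D.inLegs c) (D.outLegs c)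
      (crossingAlexanderMatrix (LaurentPolynomial.T (R := ℤ) c.sign)))).trans
    (congrArg List.sum (List.map_map ..))
  simp only [Function.comp_def, Matrix.mulVec.addMonoidHomLeft, AddMonoidHom.coe_mk,
    ZeroHom.coe_mk, crossing_mulVec] at sum_mulVec
  rw [alexanderMatrix_eq, Matrix.sub_mulVec, Matrix.one_mulVec, sum_mulVec,
    D.sum_crossings fun i _ => Pi.single i 1, sub_eq_iff_eq_add']
  exact (Finset.univ_sum_single _).symm.trans (Fin.sum_univ_castSucc _)

/-- The Gaussian matrix of the bead of a crossing. -/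
def beadMatrix (T : Rˣ) (c : Crossing) : Matrix D.Edge D.Edge R :=
  embedMatrix (D.inLegs c) (crossingGaussianMatrix (T ^ c.sign))

/-- The Gaussian matrix of the product of the beads of all crossings. -/
def beadProductMatrix (T : Rˣ) : Matrix D.Edge D.Edge R :=
  (D.tangle.crossings.map (D.beadMatrix T)).prod

theorem beadProductMatrix_eq (T : Rˣ) :
    D.beadProductMatrix T = 1 + (D.tangle.crossings.map fun c =>
      placeMatrix (D.inLegs c) (D.inLegs c) (crossingGaussianMatrix (T ^ c.sign) - 1)).sum := by
  have beadMatrix_sub_one (c : Crossing) : D.beadMatrix T c - 1 =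
      placeMatrix (D.inLegs c) (D.inLegs c) (crossingGaussianMatrix (T ^ c.sign) - 1) :=
    add_sub_cancel_left _ _
  rw [beadProductMatrix, prod_eq_one_add_sum_sub_one, List.map_map]
  · simp only [Function.comp_def, beadMatrix_sub_one]
  · refine List.pairwise_map.2 (D.pairwise_inLegs_ne.imp fun ne => ?_)
    rw [beadMatrix_sub_one, beadMatrix_sub_one, placeMatrix_mul_placeMatrix_of_ne ne]

theorem beadProductMatrix_last (T : Rˣ) :
    D.beadProductMatrix T (Fin.last D.lastEdge) = Pi.single (Fin.last D.lastEdge) 1 := by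
  refine (Matrix.single_one_vecMul ..).symm.trans ?_
  refine List.prod_induction (fun M => Matrix.vecMul (Pi.single (Fin.last D.lastEdge) 1) M =
    Pi.single (Fin.last D.lastEdge) 1) (fun M N hM hN => ?_) (Matrix.vecMul_one _)
    (List.forall_mem_map.2 fun c hc => ?_)
  · rw [← Matrix.vecMul_vecMul, hM, hN]
  · ext j
    rw [Matrix.single_one_vecMul, Matrix.row, beadMatrix,
      embedMatrix_apply_left _ fun ⟨a, ha⟩ => inLegs_ne_last hc a ha, Matrix.one_apply,
      Pi.single_apply]
    simp only [eq_comm]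

theorem shiftMatrix_eq : shiftMatrix R D.lastEdge =
    (D.tangle.crossings.map fun c => placeMatrix (D.inLegs c) (D.outLegs c) 1).sum := by
  simp only [placeMatrix_one]
  rw [D.sum_crossings fun i j => Matrix.single i j 1]
  ext i j
  cases j using Fin.cases with
  | zero => simp [shiftMatrix_zero, Matrix.sum_apply]
  | succ j =>
    simp only [shiftMatrix_succ, Matrix.sum_apply, Matrix.single_apply, Fin.succ_inj]
    simp [and_comm, ite_and, eq_comm]

theorem placeMatrix_inLegs_mul_shiftMatrix {c : Crossing} (hc : c ∈ D.tangle.crossings)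
    (r : Fin 2 → D.Edge) (M : Matrix (Fin 2) (Fin 2) R) :
    placeMatrix r (D.inLegs c) M * shiftMatrix R D.lastEdge = placeMatrix r (D.outLegs c) M := by
  refine placeMatrix_mul_of_forall_row_eq (fun a => ?_) M
  obtain ⟨e, -, he_in, he_out⟩ := exists_eq_incomingEdge hc a
  ext j
  rw [he_in, he_out]
  cases j using Fin.cases <;>
    simp [shiftMatrix_zero, shiftMatrix_succ, Pi.single_apply, eq_comm]

theorem contractionMatrix_beadProductMatrix (T : Rˣ) :
    contractionMatrix (D.beadProductMatrix T) = 1 - (D.tangle.crossings.map fun c =>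
      placeMatrix (D.inLegs c) (D.outLegs c)
        (crossingGaussianMatrix (T ^ c.sign)).transpose).sum := by
  have crossing_eq : ∀ c ∈ D.tangle.crossings,
      placeMatrix (D.inLegs c) (D.outLegs c) 1 +
        (placeMatrix (D.inLegs c) (D.inLegs c)
          (crossingGaussianMatrix (T ^ c.sign) - 1)).transpose * shiftMatrix R D.lastEdge =
      placeMatrix (D.inLegs c) (D.outLegs c) (crossingGaussianMatrix (T ^ c.sign)).transpose := by
    intro c hc
    rw [transpose_placeMatrix, D.placeMatrix_inLegs_mul_shiftMatrix hc, ← placeMatrix_add,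
      Matrix.transpose_sub, Matrix.transpose_one, add_sub_cancel]
  rw [contractionMatrix, beadProductMatrix_eq, Matrix.transpose_add, Matrix.transpose_one, add_mul,
    one_mul, Matrix.transpose_list_sum, List.map_map, ← List.sum_map_mul_right]
  nth_rewrite 1 [shiftMatrix_eq]
  rw [← List.sum_map_add, ← List.map_congr_left crossing_eq]
  rfl

end UpwardKnotDiagram

namespace UpwardKnotDiagram

variable {D : UpwardKnotDiagram}

theorem coe_inLegs {c : Crossing} (hc : c ∈ D.tangle.crossings) (a : Fin 2) :
    (D.inLegs c a : ℕ) = c.incomingEdge a := by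
  obtain ⟨e, he, he_in, -⟩ := exists_eq_incomingEdge hc a
  rw [he, he_in, Fin.val_castSucc]

theorem coe_outLegs {c : Crossing} (hc : c ∈ D.tangle.crossings) (a : Fin 2) :
    (D.outLegs c a : ℕ) = c.incomingEdge a + 1 := by
  obtain ⟨e, he, -, he_out⟩ := exists_eq_incomingEdge hc a
  rw [he, he_out, Fin.val_succ]

variable (D) in
theorem alexanderMatrix_map_evalSq_mulVec_one {R : Type*} [CommRing R] (T : Rˣ) :
    (D.alexanderMatrix.map (evalSq T)).mulVec 1 = Pi.single (Fin.last D.lastEdge) 1 := by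
  have map_one_comp : evalSq T ∘ (1 : D.Edge → LaurentPolynomial ℤ) = 1 :=
    funext fun _ => map_one (evalSq T)
  ext e
  have map_mulVec := RingHom.map_mulVec (evalSq T) D.alexanderMatrix 1 e
  rw [alexanderMatrix_mulVec_one, map_one_comp] at map_mulVec
  rw [← map_mulVec, Pi.single_apply, Pi.single_apply, apply_ite (evalSq T), map_one, map_zero]

namespace IsAlexanderNumbering

variable {μ : ℕ → ℤ} (hμ : D.IsAlexanderNumbering μ) {R : Type*} [CommRing R] (T : Rˣ)
include hμ

theorem transpose_crossingGaussianMatrix_eq {c : Crossing} (hc : c ∈ D.tangle.crossings) :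
    (crossingGaussianMatrix (T ^ c.sign)).transpose =
      Matrix.diagonal ((fun e : D.Edge => (↑(T ^ (-μ e)) : R)) ∘ D.inLegs c) *
        crossingAlexanderMatrix ((↑(T ^ c.sign) : R) ^ 2) *
        Matrix.diagonal ((fun e : D.Edge => (↑(T ^ μ e) : R)) ∘ D.outLegs c) := by
  have zpow_overEdge : T ^ μ c.overEdge = T ^ μ c.underEdge * T ^ c.sign := by
    rw [← zpow_add, ← hμ.sub_eq_sign c hc, add_sub_cancel]
  have row_eq : (fun e : D.Edge => (↑(T ^ (-μ e)) : R)) ∘ D.inLegs c =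
      ![↑(T ^ μ c.overEdge)⁻¹, ↑(T ^ μ c.underEdge)⁻¹] := by
    ext a
    rw [Function.comp_apply, coe_inLegs hc, zpow_neg]
    fin_cases a <;> rfl
  have col_eq : (fun e : D.Edge => (↑(T ^ μ e) : R)) ∘ D.outLegs c =
      ![↑(T ^ μ c.underEdge), ↑(T ^ μ c.overEdge)] := by
    rw [← hμ.overEdge_succ c hc, ← hμ.underEdge_succ c hc]
    ext a
    rw [Function.comp_apply, coe_outLegs hc]
    fin_cases a <;> rfl
  rw [row_eq, col_eq, zpow_overEdge, diagonal_mul_crossingAlexanderMatrix_mul_diagonal]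

theorem contractionMatrix_beadProductMatrix_eq :
    contractionMatrix (D.beadProductMatrix T) =
      Matrix.diagonal (fun e : D.Edge => (↑(T ^ (-μ e)) : R)) *
        D.alexanderMatrix.map (evalSq T) *
        Matrix.diagonal fun e : D.Edge => (↑(T ^ μ e) : R) := by
  have diagonal_mul_diagonal : Matrix.diagonal (fun e : D.Edge => (↑(T ^ (-μ e)) : R)) *
      Matrix.diagonal (fun e : D.Edge => (↑(T ^ μ e) : R)) = 1 := by
    simp [Matrix.diagonal_mul_diagonal]
  rw [D.alexanderMatrix_map_evalSq, mul_sub, sub_mul, mul_one, diagonal_mul_diagonal,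
    ← List.sum_map_mul_left, ← List.sum_map_mul_right, D.contractionMatrix_beadProductMatrix]
  refine congrArg (1 - List.sum ·) (List.map_congr_left fun c hc => ?_)
  rw [diagonal_mul_placeMatrix_mul_diagonal, hμ.transpose_crossingGaussianMatrix_eq T hc]

theorem contractionMatrix_beadProductMatrix_mulVec :
    (contractionMatrix (D.beadProductMatrix T)).mulVec (fun e => (↑(T ^ (-μ e)) : R)) =
      Pi.single (Fin.last D.lastEdge) 1 := by
  have diagonal_mulVec : (Matrix.diagonal fun e : D.Edge => (↑(T ^ μ e) : R)).mulVec
      (fun e => (↑(T ^ (-μ e)) : R)) = 1 := by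
    ext e
    simp [Matrix.mulVec_diagonal]
  rw [hμ.contractionMatrix_beadProductMatrix_eq, ← Matrix.mulVec_mulVec, diagonal_mulVec,
    ← Matrix.mulVec_mulVec, D.alexanderMatrix_map_evalSq_mulVec_one]
  ext e
  obtain rfl | he := eq_or_ne e (Fin.last _)
  · simp [Matrix.mulVec_diagonal, hμ.last]
  · simp [Matrix.mulVec_diagonal, he]

end IsAlexanderNumbering

variable (D)

theorem det_contractionMatrix_beadProductMatrix {R : Type*} [CommRing R] (T : Rˣ) :
    (contractionMatrix (D.beadProductMatrix T)).det = evalSq T D.alexanderPolynomial := by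
  obtain ⟨μ, hμ⟩ := D.exists_isAlexanderNumbering
  rw [hμ.contractionMatrix_beadProductMatrix_eq, Matrix.det_mul_right_comm,
    Matrix.diagonal_mul_diagonal, alexanderPolynomial, RingHom.map_det, RingHom.mapMatrix_apply]
  simp

theorem inv_contractionMatrix_beadProductMatrix_apply {R : Type*} [CommRing R] {T : Rˣ}
    (h : IsUnit (contractionMatrix (D.beadProductMatrix T)).det) :
    (contractionMatrix (D.beadProductMatrix T))⁻¹ 0 (Fin.last D.lastEdge) = 1 := by
  obtain ⟨μ, hμ⟩ := D.exists_isAlexanderNumbering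
  rw [inv_apply_of_mulVec_eq_single h (hμ.contractionMatrix_beadProductMatrix_mulVec T)]
  simp [hμ.first]

end UpwardKnotDiagram

/-! ### The universal invariant -/

section UniversalInvariant

variable {k : Type*} [Field k] {T : k⟦X⟧ˣ}

theorem crossingGaussianMatrix_map_constantCoeff (hT : constantCoeff (T : k⟦X⟧) = 1) :
    (crossingGaussianMatrix T).map constantCoeff = 1 := by
  ext i j
  fin_cases i <;> fin_cases j <;> simp [crossingGaussianMatrix, hT]

theorem isGaussian_gaussianUnit_zpow_sign [CharZero k] (hT : constantCoeff (T : k⟦X⟧) = 1)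
    (c : Crossing) :
    IsGaussian (legGen .x) (legGen .p)
      (↑(gaussianUnit (crossingGaussianMatrix T) ^ c.sign) : (HeisenbergPow k 2)⟦X⟧)
      (crossingGaussianMatrix (T ^ c.sign)) := by
  have hT_inv : constantCoeff (↑T⁻¹ : k⟦X⟧) = 1 := by
    simp [hT]
  have map_eq_one := crossingGaussianMatrix_map_constantCoeff hT
  have map_inv_eq_one := crossingGaussianMatrix_map_constantCoeff hT_inv
  rw [Crossing.sign]
  split_ifs
  · rw [zpow_one, zpow_one]
    exact isGaussian_gaussian map_eq_one
  · rw [zpow_neg_one, zpow_neg_one, coe_gaussianUnit_inv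
      (crossingGaussianMatrix_mul_inv T) map_eq_one map_inv_eq_one]
    exact isGaussian_gaussian map_inv_eq_one

namespace UpwardKnotDiagram

variable {D : UpwardKnotDiagram}

theorem isGaussian_crossingBead [CharZero k] (hT : constantCoeff (T : k⟦X⟧) = 1) {c : Crossing}
    (hc : c ∈ D.tangle.crossings) :
    IsGaussian (legGen .x) (legGen .p)
      (D.crossingBead (gaussianUnit (crossingGaussianMatrix T)) c) (D.beadMatrix T c) := by
  have ne : D.inLegs c 0 ≠ D.inLegs c 1 := (inLegs_injective hc).ne zero_ne_one
  have inLegs_eq : ![D.inLegs c 0, D.inLegs c 1] = D.inLegs c := List.ofFn_inj.1 rfl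
  have map_legGen (g : HeisenbergGen) (a : Fin 2) :
      placeLegsAlgHom ne (legGen g a) =
        (legGen g (D.inLegs c a) : ⨂[k] _ : D.Edge, Heisenberg k) := by
    rw [legGen, placeLegsAlgHom_tensorLeg, inLegs_eq, legGen]
  have commute (g : HeisenbergGen) : ∀ l ∉ Set.range (D.inLegs c), ∀ z,
      Commute (legGen g l : ⨂[k] _ : D.Edge, Heisenberg k) (placeLegsAlgHom ne z) :=
    fun l hl z => commute_tensorLeg_placeLegs (fun h => hl ⟨0, h.symm⟩)
      (fun h => hl ⟨1, h.symm⟩) _ z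
  have gaussian_map := (isGaussian_gaussianUnit_zpow_sign hT c).map (inLegs_injective hc)
    (map_legGen .x) (map_legGen .p) (commute .x) (commute .p)
  rwa [← deform_algHom, placeLegsAlgHom_toLinearMap] at gaussian_map

variable (D)

/-- The product of the beads of all crossings of `D`, for `R = φ [[T, 0], [1 - T², T]]`. -/
def beadProduct (T : k⟦X⟧ˣ) : PowerSeries (⨂[k] _ : D.Edge, Heisenberg k) :=
  (D.tangle.crossings.map (D.crossingBead (gaussianUnit (crossingGaussianMatrix T)))).prod

theorem universalInvariant_eq_deform_beadProduct :
    D.universalInvariant (gaussianUnit (crossingGaussianMatrix T)) 1 =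
      deform (contractLegs (D.lastEdge + 1)) (D.beadProduct T) := by
  have turnBead_one (e : D.Edge) :
      D.turnBead (k := k) (1 : (Heisenberg k)⟦X⟧ˣ) e = 1 := by
    rw [turnBead, one_zpow, Units.val_one, deform_algHom, map_one]
  rw [universalInvariant, List.prod_eq_one (l := List.ofFn _), mul_one, beadProduct]
  exact List.forall_mem_ofFn_iff.2 turnBead_one

variable [CharZero k]

theorem isGaussian_beadProduct (hT : constantCoeff (T : k⟦X⟧) = 1) :
    IsGaussian (legGen .x) (legGen .p) (D.beadProduct T) (D.beadProductMatrix T) :=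
  IsGaussian.list_prod _ _ _ fun _ hc => isGaussian_crossingBead hT hc

theorem commute_universalInvariant (hT : constantCoeff (T : k⟦X⟧) = 1) (g : HeisenbergGen) :
    Commute (C (heisenbergGen g))
      (D.universalInvariant (gaussianUnit (crossingGaussianMatrix T)) 1) := by
  have gaussian := D.isGaussian_beadProduct hT
  have last := D.beadProductMatrix_last T
  have inv_apply :=
    D.inv_contractionMatrix_beadProductMatrix_apply gaussian.isUnit_det_contractionMatrix
  rw [universalInvariant_eq_deform_beadProduct]
  cases g with
  | x => exact gaussian.commute_x_deform (isContraction_contractLegs _) last inv_apply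
  | p => exact gaussian.commute_p_deform (isContraction_contractLegs _) last inv_apply

theorem vacuum_universalInvariant_mul (hT : constantCoeff (T : k⟦X⟧) = 1) :
    deform vacuum (D.universalInvariant (gaussianUnit (crossingGaussianMatrix T)) 1) *
      evalSq T D.alexanderPolynomial = 1 := by
  have isVacuum := isVacuumExpectation_vacuum (k := k) (σ := Unit)
  rw [universalInvariant_eq_deform_beadProduct, ← det_contractionMatrix_beadProductMatrix]
  exact (D.isGaussian_beadProduct hT).functional_mul_det_contractionMatrix
    (isContraction_contractLegs _) legGen_p_mul_legGen_x (isVacuum.map_x_mul ())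
    ((congrArg vacuum (contractLegs_map_one _)).trans isVacuum.map_one)

end UpwardKnotDiagram

end UniversalInvariant

section ScalarPart

variable {k : Type*} [Field k]

theorem one_mem_expMatrices (n : ℕ) : 1 ∈ expMatrices k n := by
  refine ⟨0, ?_⟩
  ext i j d
  rw [matrixExp, Matrix.of_apply, PowerSeries.coeff_mk, Finset.sum_range_succ',
    Finset.sum_eq_zero]
  · simp
  · intro m _
    simp

theorem IsScalarPart.eq_vacuum {Z : (Heisenberg k)⟦X⟧} {ω : k⟦X⟧} (h : IsScalarPart Z ω) :
    ω = deform vacuum Z := by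
  obtain ⟨Q, -, rfl⟩ := h
  rw [← smul_eq_map_mul, deform_functional_smul, deform_vacuum_gaussian, mul_one]

theorem isScalarPart_map_algebraMap [CharZero k] (ω : k⟦X⟧) :
    IsScalarPart (PowerSeries.map (algebraMap k (Heisenberg k)) ω) ω := by
  refine ⟨1, one_mem_expMatrices 1, ?_⟩
  rw [gaussian_one, ← map_one C, deform_C, contractLegs_map_one, map_one, mul_one]

theorem constantCoeff_expT [CharZero k] (t : k) : constantCoeff (expT t : k⟦X⟧) = 1 := by
  change constantCoeff (PowerSeries.rescale t (PowerSeries.exp k)) = 1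
  rw [← PowerSeries.coeff_zero_eq_constantCoeff_apply, PowerSeries.coeff_rescale]
  simp

end ScalarPart

theorem mainTheorem1_general {k : Type*} [Field k] [CharZero k] {T : k⟦X⟧ˣ}
    (hT : constantCoeff (T : k⟦X⟧) = 1) (D : UpwardKnotDiagram) :
    (∃! ω : k⟦X⟧, IsScalarPart
      (D.universalInvariant (gaussianUnit !![(T : k⟦X⟧), 0; 1 - (T : k⟦X⟧) ^ 2, T]) 1) ω) ∧
    ∀ ω : k⟦X⟧, IsScalarPart
      (D.universalInvariant (gaussianUnit !![(T : k⟦X⟧), 0; 1 - (T : k⟦X⟧) ^ 2, T]) 1) ω →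
      ω * LaurentPolynomial.eval₂ (Int.castRingHom k⟦X⟧) (T ^ 2) D.alexanderPolynomial = 1 := by
  set Z := D.universalInvariant (gaussianUnit (crossingGaussianMatrix T)) 1
  have scalar : Z = PowerSeries.map (algebraMap k (Heisenberg k)) (deform vacuum Z) :=
    eq_map_algebraMap_vacuum_of_commute (D.commute_universalInvariant hT)
  refine ⟨⟨deform vacuum Z, ?_, fun ω hω => hω.eq_vacuum⟩, fun ω hω => ?_⟩
  · have isScalarPart := isScalarPart_map_algebraMap (deform vacuum Z)
    rwa [← scalar] at isScalarPart
  · rw [hω.eq_vacuum]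
    exact D.vacuum_universalInvariant_mul hT

end

theorem mainTheorem1 {k : Type*} [Field k] [CharZero k] (t : k) (D : UpwardKnotDiagram) :
    (∃! ω : PowerSeries k, IsScalarPart (D.universalInvariant (heisenbergR t) 1) ω) ∧
    ∀ ω : PowerSeries k, IsScalarPart (D.universalInvariant (heisenbergR t) 1) ω →
      ∃ (ε : ℤˣ) (n : ℤ),
        ω * LaurentPolynomial.eval₂ (Int.castRingHom (PowerSeries k)) (expT t ^ 2)
            D.alexanderPolynomial =
          ((ε : ℤ) : PowerSeries k) * ((expT t ^ n : (PowerSeries k)ˣ) : PowerSeries k) := by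
  obtain ⟨existsUnique, mul_eq_one⟩ := mainTheorem1_general (constantCoeff_expT t) D
  exact ⟨existsUnique, fun ω hω => ⟨1, 0, (mul_eq_one ω hω).trans (by simp)⟩⟩
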